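/- Let $\mathcal S,\mathcal X_1,\mathcal X_2,\mathcal Y_2,\mathcal Y_3$ be finite alphabets, nonempty input alphabets. A discrete memoryless state-dependent relay channel with informed source is given by a probability law $Q_S$ on $\mathcal S$ and a transition law $W_{Y_2,Y_3|X_1,X_2,S}$. An $(M,n)$ code consists of a source encoder $\phi_1^n:\{1,\dots,M\}\times\mathcal S^n\to\mathcal X_1^n$ (the source knows the whole state sequence noncausally), relay encoders $\phi_{2,i}:\mathcal Y_2^{i-1}\to\mathcal X_2$, $i=1,\dots,n$, and a decoder $\psi^n:\mathcal Y_3^n\to\{1,\dots,M\}$. The message $w$ is uniform on $\{1,\dots,M\}$, the state sequence $s^n$ is i.i.d. with law $Q_S$ and independent of the message, and, with $x_1^n=\phi_1^n(w,s^n)$ and $x_{2,i}=\phi_{2,i}(y_2^{i-1})$, the outputs at time $i$ are drawn from $W_{Y_2,Y_3|X_1,X_2,S}(\cdot\mid x_{1,i},x_{2,i},s_i)$. The error probability $P_e^n$ is the probability that $\psi^n(Y_3^n)$ differs from the message. A rate $R\ge 0$ is achievable if there are $\epsilon_n\to 0$ and, for every $n\ge 1$, a $(\lceil 2^{nR}\rceil,n)$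 code with $P_e^n\le\epsilon_n$. The capacity is the supremum of the achievable rates. Theorem. The capacity is at most $$R^{\mathrm{up}}=\max\ \min\{\,I(V;Y_2,Y_3|U,X_2)-I(V;S|U,X_2),\ \ I(V;Y_3)-I(V;S)\,\},$$ where logarithms are to base $2$, the maximum (which is attained) is over all joint laws of the form $$P_{S,U,V,X_1,X_2,Y_2,Y_3}=Q_S\,P_{U|S}\,P_{X_2|U,S}\,P_{V,X_1|U,S}\,W_{Y_2,Y_3|X_1,X_2,S},$$ and $U\in\mathcal U$, $V\in\mathcal V$ are auxiliary random variables on finite alphabets with $$|\mathcal U|\le|\mathcal S||\mathcal X_1||\mathcal X_2|,\qquad |\mathcal V|\le\big(|\mathcal S||\mathcal X_1||\mathcal X_2|\big)^2.$$ -/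

import Mathlib

noncomputable section

/-! ### Information measures of finite random variables (in bits) -/

section Information

variable {Ω A B C : Type*} [Fintype Ω] [Fintype A] [Fintype B] [Fintype C]

open scoped Classical in
/-- The probability mass function of the random variable `X : Ω → A` when the sample space `Ω`
carries the probability mass function `μ`. -/
def rvLaw (μ : Ω → ℝ) (X : Ω → A) (a : A) : ℝ :=
  ∑ ω, if X ω = a then μ ω else 0

/-- Shannon entropy `H(X)`, with logarithm to base 2. -/
def rvEntropy (μ : Ω → ℝ) (X : Ω → A) : ℝ :=
  ∑ a, Real.negMulLog (rvLaw μ X a) / Real.log 2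

/-- Conditional entropy `H(X | Z) = H(X, Z) - H(Z)`. -/
def rvCondEntropy (μ : Ω → ℝ) (X : Ω → A) (Z : Ω → C) : ℝ :=
  rvEntropy μ (fun ω => (X ω, Z ω)) - rvEntropy μ Z

/-- Mutual information `I(X; Y) = H(X) - H(X | Y)`. -/
def rvMutualInfo (μ : Ω → ℝ) (X : Ω → A) (Y : Ω → B) : ℝ :=
  rvEntropy μ X - rvCondEntropy μ X Y

/-- Conditional mutual information `I(X; Y | Z) = H(X | Z) - H(X | Y, Z)`. -/
def rvCondMutualInfo (μ : Ω → ℝ) (X : Ω → A) (Y : Ω → B) (Z : Ω → C) : ℝ :=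
  rvCondEntropy μ X Z - rvCondEntropy μ X (fun ω => (Y ω, Z ω))

end Information

/-! ### The channel, its codes and its capacity -/

/-- A discrete memoryless state-dependent relay channel: the law `Q` of one state symbol and the
one-use transition law `W(y₂, y₃ | x₁, x₂, s)`. -/
structure StateRelayChannel (S X₁ X₂ Y₂ Y₃ : Type*)
    [Fintype S] [Fintype X₁] [Fintype X₂] [Fintype Y₂] [Fintype Y₃] where
  /-- the law of one state symbol -/
  Q : S → ℝ
  Q_mem : Q ∈ stdSimplex ℝ S
  /-- the transition law -/
  W : X₁ → X₂ → S → Y₂ × Y₃ → ℝ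
  W_mem : ∀ x₁ x₂ s, W x₁ x₂ s ∈ stdSimplex ℝ (Y₂ × Y₃)

/-- An `(M, n)` code. The source knows the message and the whole state sequence; the relay input
at time `i` is a function of the relay outputs at the times before `i`; the destination decodes
from its whole output sequence. -/
structure RelayCode (S X₁ X₂ Y₂ Y₃ : Type*) (M n : ℕ) where
  /-- source encoder -/
  source : Fin M → (Fin n → S) → Fin n → X₁
  /-- relay encoders -/
  relay : (i : Fin n) → (Fin (i : ℕ) → Y₂) → X₂
  /-- decoder -/
  decoder : (Fin n → Y₃) → Fin M

namespace StateRelayChannel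

variable {S X₁ X₂ Y₂ Y₃ : Type*}
  [Fintype S] [Fintype X₁] [Fintype X₂] [Fintype Y₂] [Fintype Y₃]

/-- The relay input at time `i` when the relay output sequence is `y₂`. -/
def relayInput {M n : ℕ} (c : RelayCode S X₁ X₂ Y₂ Y₃ M n) (y₂ : Fin n → Y₂) (i : Fin n) : X₂ :=
  c.relay i (fun j => y₂ (Fin.castLE i.isLt.le j))

/-- The joint probability of message `w` (uniform), state sequence `s` (i.i.d.), relay outputs `y₂`
and destination outputs `y₃`; the two input sequences are the ones which the encoders determine. -/
def codeLaw (ch : StateRelayChannel S X₁ X₂ Y₂ Y₃) {M n : ℕ} (c : RelayCode S X₁ X₂ Y₂ Y₃ M n)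
    (w : Fin M) (s : Fin n → S) (y₂ : Fin n → Y₂) (y₃ : Fin n → Y₃) : ℝ :=
  (1 / (M : ℝ)) *
    ∏ i, (ch.Q (s i) * ch.W (c.source w s i) (relayInput c y₂ i) (s i) (y₂ i, y₃ i))

/-- The average probability of error. -/
def errorProb (ch : StateRelayChannel S X₁ X₂ Y₂ Y₃) {M n : ℕ}
    (c : RelayCode S X₁ X₂ Y₂ Y₃ M n) : ℝ :=
  ∑ w : Fin M, ∑ s : Fin n → S, ∑ y₂ : Fin n → Y₂, ∑ y₃ : Fin n → Y₃,
    if c.decoder y₃ ≠ w then ch.codeLaw c w s y₂ y₃ else 0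

/-- The rate `R ≥ 0` is achievable: for every block length `n ≥ 1` there is a code with
`⌈2 ^ (n R)⌉` messages whose error probability is at most `ε n`, where `ε n → 0`. -/
def Achievable (ch : StateRelayChannel S X₁ X₂ Y₂ Y₃) (R : ℝ) : Prop :=
  0 ≤ R ∧ ∃ ε : ℕ → ℝ, Filter.Tendsto ε Filter.atTop (nhds 0) ∧
    ∀ n : ℕ, 1 ≤ n → ∃ c : RelayCode S X₁ X₂ Y₂ Y₃ ⌈(2 : ℝ) ^ ((n : ℝ) * R)⌉₊ n,
      ch.errorProb c ≤ ε n

/-- The capacity: the supremum of the achievable rates, taken in the extended reals. -/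
def capacity (ch : StateRelayChannel S X₁ X₂ Y₂ Y₃) : EReal :=
  sSup ((fun R : ℝ => (R : EReal)) '' {R | ch.Achievable R})

/-! ### The single-letter upper bound -/

variable {U V : Type*} [Fintype U] [Fintype V]

/-- `μ` is a joint law of `(S, U, V, X₁, X₂, Y₂, Y₃)` of the form
`Q_S P_{U|S} P_{X₂|U,S} P_{V,X₁|U,S} W_{Y₂,Y₃|X₁,X₂,S}`. -/
def IsTestLaw (ch : StateRelayChannel S X₁ X₂ Y₂ Y₃)
    (μ : S × U × V × X₁ × X₂ × Y₂ × Y₃ → ℝ) : Prop :=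
  ∃ (pU : S → U → ℝ) (pX₂ : U → S → X₂ → ℝ) (pVX₁ : U → S → V × X₁ → ℝ),
    (∀ s, pU s ∈ stdSimplex ℝ U) ∧
    (∀ u s, pX₂ u s ∈ stdSimplex ℝ X₂) ∧
    (∀ u s, pVX₁ u s ∈ stdSimplex ℝ (V × X₁)) ∧
    ∀ s u v x₁ x₂ y₂ y₃,
      μ (s, u, v, x₁, x₂, y₂, y₃) =
        ch.Q s * pU s u * pX₂ u s x₂ * pVX₁ u s (v, x₁) * ch.W x₁ x₂ s (y₂, y₃)

/-- The coordinate `S`. -/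
def rvS (ω : S × U × V × X₁ × X₂ × Y₂ × Y₃) : S := ω.1

/-- The coordinate `V`. -/
def rvV (ω : S × U × V × X₁ × X₂ × Y₂ × Y₃) : V := ω.2.2.1

/-- The pair `(U, X₂)`. -/
def rvUX₂ (ω : S × U × V × X₁ × X₂ × Y₂ × Y₃) : U × X₂ := (ω.2.1, ω.2.2.2.2.1)

/-- The pair `(Y₂, Y₃)`. -/
def rvY₂Y₃ (ω : S × U × V × X₁ × X₂ × Y₂ × Y₃) : Y₂ × Y₃ := ω.2.2.2.2.2

/-- The coordinate `Y₃`. -/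
def rvY₃ (ω : S × U × V × X₁ × X₂ × Y₂ × Y₃) : Y₃ := ω.2.2.2.2.2.2

/-- `min {I(V; Y₂, Y₃ | U, X₂) - I(V; S | U, X₂), I(V; Y₃) - I(V; S)}` under the joint law `μ`. -/
def boundObjective (μ : S × U × V × X₁ × X₂ × Y₂ × Y₃ → ℝ) : ℝ :=
  min (rvCondMutualInfo μ rvV rvY₂Y₃ rvUX₂ - rvCondMutualInfo μ rvV rvS rvUX₂)
    (rvMutualInfo μ rvV rvY₃ - rvMutualInfo μ rvV rvS)

/-- All values of the objective, over the test laws whose auxiliary alphabets have cardinalities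
`|U| ≤ |S| |X₁| |X₂|` and `|V| ≤ (|S| |X₁| |X₂|) ^ 2`. -/
def boundValues (ch : StateRelayChannel S X₁ X₂ Y₂ Y₃) : Set ℝ :=
  {r | ∃ a b : ℕ,
    a ≤ Fintype.card S * Fintype.card X₁ * Fintype.card X₂ ∧
    b ≤ (Fintype.card S * Fintype.card X₁ * Fintype.card X₂) ^ 2 ∧
    ∃ μ : S × Fin a × Fin b × X₁ × X₂ × Y₂ × Y₃ → ℝ, ch.IsTestLaw μ ∧ r = boundObjective μ}

end StateRelayChannel

end

noncomputable section

set_option linter.unusedSectionVars false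

/-! ### Entropies of finite random variables under possibly unnormalised laws. -/

section Information

open scoped Classical

variable {Ω Ω' A B C D : Type*} [Fintype Ω] [Fintype Ω'] [Fintype A] [Fintype B] [Fintype C]
  [Fintype D]

/-! The choice `U = (S, X₂)` makes the bound tractable. The relay input is then a function of `U`,
so every law of `(S, V, X₁, X₂)` with state marginal `Q` has the factorisation required of a test
law (`isTestLaw_of_state_input`). If moreover `X₁` is a function of `(V, S, X₂)`, the first term of
the minimum becomes `I(X₁; Y₂, Y₃ | S, X₂)` (`boundObjective_of_deterministic`). It is therefore
enough to bound rates by this term and by `I(V; Y₃) - I(V; S)`.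

For a code, Fano's inequality reduces the question to the information which `Y₃ⁿ` carries about the
message `W`. Revealing `Y₂ⁿ` and `Sⁿ` to the destination bounds it by the sum of the `I(X₁ᵢ; Y₂ᵢ,
Y₃ᵢ | Sᵢ, X₂ᵢ)` (`message_info_le_sum_broadcastTerm`). With `Vᵢ = (W, Y₃^{i-1}, S_{i+1}ⁿ)` it is
also at most the sum of the `I(Vᵢ; Y₃ᵢ) - I(Vᵢ; Sᵢ)` (`message_info_le_sum_entropyGap`). A uniform
time index, absorbed into `V`, turns both sums into single-letter expressions: the first term is
concave in the input law, and `H(S) - H(Y₃)` is convex once the state law is fixed.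

Two changes of `V` remain (`exists_mem_boundValues`). Adjoining to `V` a random function from `(S,
X₂)` to `X₁` makes `X₁` deterministic and does not decrease the second term, by concavity of
`H(Y₃)`. A conic Carathéodory argument then keeps the law of `(S, X₁, X₂)`, hence the first term,
and leaves at most `|S| |X₁| |X₂|` values of `V` without decreasing the second term, which is linear
in the weights up to a constant. The slices `V = v` are kept unnormalised throughout, which avoids
dividing by `P(V = v)`.

The maximum is attained because the alphabet bounds leave finitely many compact families of test
laws and the objective is continuous. -/

theorem rvLaw_nonneg {μ : Ω → ℝ} (hμ : ∀ ω, 0 ≤ μ ω) (X : Ω → A) (a : A) : 0 ≤ rvLaw μ X a :=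
  Finset.sum_nonneg fun ω _ => by split_ifs <;> simp [hμ ω]

/-- Change of variables: expectations of functions of `X` are computed from the law of `X`. -/
theorem sum_rvLaw_mul (μ : Ω → ℝ) (X : Ω → A) (F : A → ℝ) :
    ∑ a, rvLaw μ X a * F a = ∑ ω, μ ω * F (X ω) := by
  classical
  simp only [rvLaw, Finset.sum_mul]
  rw [Finset.sum_comm]
  refine Finset.sum_congr rfl fun ω _ => ?_
  rw [Finset.sum_eq_single (X ω)] <;> simp +contextual [eq_comm]

theorem sum_rvLaw (μ : Ω → ℝ) (X : Ω → A) : ∑ a, rvLaw μ X a = ∑ ω, μ ω := by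
  simpa using sum_rvLaw_mul μ X fun _ => 1

theorem rvLaw_eq_sum_mul [DecidableEq A] (μ : Ω → ℝ) (X : Ω → A) (a : A) :
    rvLaw μ X a = ∑ ω, μ ω * (if X ω = a then 1 else 0) := by
  refine Finset.sum_congr rfl fun ω _ => ?_
  by_cases h : X ω = a <;> simp [h]

theorem rvLaw_comp_injective (μ : Ω → ℝ) (X : Ω → A) {f : A → B} (hf : Function.Injective f)
    (a : A) : rvLaw μ (fun ω => f (X ω)) (f a) = rvLaw μ X a := by
  simp only [rvLaw, hf.eq_iff]

theorem rvLaw_rvLaw (μ : Ω → ℝ) (Φ : Ω → Ω') (X : Ω' → A) :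
    rvLaw (rvLaw μ Φ) X = rvLaw μ (fun ω => X (Φ ω)) := by
  ext a
  rw [rvLaw_eq_sum_mul, sum_rvLaw_mul, rvLaw_eq_sum_mul]

theorem rvLaw_id (μ : Ω → ℝ) : rvLaw μ (fun ω => ω) = μ := by
  ext a; simp [rvLaw]

theorem rvEntropy_rvLaw (μ : Ω → ℝ) (Φ : Ω → Ω') (X : Ω' → A) :
    rvEntropy (rvLaw μ Φ) X = rvEntropy μ (fun ω => X (Φ ω)) := by
  simp only [rvEntropy, rvLaw_rvLaw]

theorem rvEntropy_eq_expectation (μ : Ω → ℝ) (X : Ω → A) :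
    rvEntropy μ X = -(∑ ω, μ ω * Real.log (rvLaw μ X (X ω))) / Real.log 2 := by
  rw [← sum_rvLaw_mul μ X fun a => Real.log (rvLaw μ X a), rvEntropy, ← Finset.sum_div,
    ← Finset.sum_neg_distrib]
  simp [Real.negMulLog]

theorem rvEntropy_mul_log (μ : Ω → ℝ) (X : Ω → A) :
    rvEntropy μ X * Real.log 2 = ∑ a, Real.negMulLog (rvLaw μ X a) := by
  rw [rvEntropy, ← Finset.sum_div, div_mul_cancel₀]
  exact (Real.log_pos one_lt_two).ne'

/-- Variables which determine each other almost surely have the same entropy. -/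
theorem rvEntropy_congr {μ : Ω → ℝ} {X : Ω → A} {Y : Ω → B}
    (h : ∀ ω ω', μ ω ≠ 0 → μ ω' ≠ 0 → (X ω = X ω' ↔ Y ω = Y ω')) :
    rvEntropy μ X = rvEntropy μ Y := by
  rw [rvEntropy_eq_expectation, rvEntropy_eq_expectation]
  congr 2
  refine Finset.sum_congr rfl fun ω _ => ?_
  rcases eq_or_ne (μ ω) 0 with h0 | h0
  · simp [h0]
  congr 2
  refine Finset.sum_congr rfl fun ω' _ => ?_
  rcases eq_or_ne (μ ω') 0 with h0' | h0'
  · simp [h0']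
  simp only [h ω' ω h0' h0]

/-- Gibbs' inequality, from `log t ≤ t - 1` at `t = q / p`. The support condition is needed because
`Real.log 0 = 0` would otherwise hide an infinite divergence. -/
theorem sum_mul_log_le_sum_mul_log {p q : A → ℝ} (hp : ∀ a, 0 ≤ p a) (hq : ∀ a, 0 ≤ q a)
    (hpq : ∀ a, q a = 0 → p a = 0) (hsum : ∑ a, q a ≤ ∑ a, p a) :
    ∑ a, p a * Real.log (q a) ≤ ∑ a, p a * Real.log (p a) := by
  have key : ∀ a, p a * Real.log (q a) - p a * Real.log (p a) ≤ q a - p a := by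
    intro a
    rcases (hp a).eq_or_lt with h0 | h0
    · simp [← h0, hq a]
    have hqa : 0 < q a := (hq a).lt_of_ne' fun h => h0.ne' (hpq a h)
    rw [← mul_sub, ← Real.log_div hqa.ne' h0.ne']
    calc p a * Real.log (q a / p a) ≤ p a * (q a / p a - 1) :=
          mul_le_mul_of_nonneg_left (Real.log_le_sub_one_of_pos (by positivity)) h0.le
      _ = q a - p a := by field_simp
  have := Finset.sum_le_sum fun a (_ : a ∈ Finset.univ) => key a
  simp only [Finset.sum_sub_distrib] at this
  linarith

/-- Entropy of a pair is at most the sum of the entropies, for an unnormalised joint law. -/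
theorem sum_negMulLog_add_le (p : A → B → ℝ) (hp : ∀ a b, 0 ≤ p a b) :
    (∑ a, ∑ b, Real.negMulLog (p a b)) + Real.negMulLog (∑ a, ∑ b, p a b) ≤
      (∑ a, Real.negMulLog (∑ b, p a b)) + ∑ b, Real.negMulLog (∑ a, p a b) := by
  set t := ∑ a, ∑ b, p a b with ht
  set r := fun a => ∑ b, p a b with hr
  set c := fun b => ∑ a, p a b with hc
  have hr0 : ∀ a, 0 ≤ r a := fun a => Finset.sum_nonneg fun b _ => hp a b
  have hc0 : ∀ b, 0 ≤ c b := fun b => Finset.sum_nonneg fun a _ => hp a b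
  have hrt : ∑ a, r a = t := rfl
  have hct : ∑ b, c b = t := Finset.sum_comm
  have ht0 : 0 ≤ t := hrt ▸ Finset.sum_nonneg fun a _ => hr0 a
  have hpr : ∀ a b, p a b ≤ r a := fun a b =>
    Finset.single_le_sum (fun b _ => hp a b) (Finset.mem_univ b)
  have hpc : ∀ a b, p a b ≤ c b := fun a b =>
    Finset.single_le_sum (f := fun a => p a b) (fun a _ => hp a b) (Finset.mem_univ a)
  have hrt' : ∀ a, r a ≤ t := fun a =>
    Finset.single_le_sum (fun a _ => hr0 a) (Finset.mem_univ a)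
  have hz : ∀ a b, r a * c b / t = 0 → p a b = 0 := by
    intro a b h
    have h1 := hpr a b
    have h2 := hpc a b
    have h3 := hrt' a
    have h4 := hp a b
    rcases div_eq_zero_iff.1 h with h | h
    · rcases mul_eq_zero.1 h with h | h <;> linarith
    · linarith
  -- Compare the joint law with the product of its marginals, rescaled by `t` to the same total
  -- mass; for `t = 0` everything vanishes.
  have gibbs := sum_mul_log_le_sum_mul_log (A := A × B) (p := fun x => p x.1 x.2)
    (q := fun x => r x.1 * c x.2 / t) (fun x => hp _ _)
    (fun x => div_nonneg (mul_nonneg (hr0 _) (hc0 _)) ht0) (fun x => hz _ _) (by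
      rw [Fintype.sum_prod_type, Fintype.sum_prod_type]
      simp only [← Finset.sum_div, ← Finset.mul_sum, ← Finset.sum_mul]
      change (∑ a, r a) * (∑ b, c b) / t ≤ t
      rw [hrt, hct]
      exact (mul_self_div_self t).le)
  have hlog : ∀ a b, p a b * Real.log (r a * c b / t) =
      p a b * Real.log (r a) + p a b * Real.log (c b) - p a b * Real.log t := by
    intro a b
    rcases eq_or_ne (p a b) 0 with h | h
    · simp [h]
    have hne : r a * c b / t ≠ 0 := fun h' => h (hz a b h')
    have hne1 := (div_ne_zero_iff.1 hne)
    have hne2 := mul_ne_zero_iff.1 hne1.1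
    rw [Real.log_div hne1.1 hne1.2, Real.log_mul hne2.1 hne2.2]
    ring
  rw [Fintype.sum_prod_type, Fintype.sum_prod_type] at gibbs
  simp only [hlog, Finset.sum_sub_distrib, Finset.sum_add_distrib] at gibbs
  have e1 : ∑ a, ∑ b, p a b * Real.log (r a) = -∑ a, Real.negMulLog (r a) := by
    simp [Real.negMulLog, hr, Finset.sum_mul]
  have e2 : ∑ a, ∑ b, p a b * Real.log (c b) = -∑ b, Real.negMulLog (c b) := by
    rw [Finset.sum_comm]; simp [Real.negMulLog, hc, Finset.sum_mul]
  have e3 : ∑ a, ∑ b, p a b * Real.log t = -Real.negMulLog t := by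
    simp only [Real.negMulLog, neg_neg, neg_mul, ← Finset.sum_mul]
    rfl
  have e4 : ∑ a, ∑ b, p a b * Real.log (p a b) = -∑ a, ∑ b, Real.negMulLog (p a b) := by
    simp [Real.negMulLog]
  rw [e1, e2, e3, e4] at gibbs
  linarith

theorem rvLaw_fst_marginal (μ : Ω → ℝ) (X : Ω → A) (Z : Ω → C) (c : C) :
    rvLaw μ Z c = ∑ a, rvLaw μ (fun ω => (X ω, Z ω)) (a, c) := by
  simp only [rvLaw]
  rw [Finset.sum_comm]
  refine Finset.sum_congr rfl fun ω _ => ?_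
  rw [Finset.sum_eq_single (X ω)] <;> simp +contextual [eq_comm]

/-- Strong subadditivity (nonnegativity of conditional mutual information). -/
theorem rvEntropy_submodular {μ : Ω → ℝ} (hμ : ∀ ω, 0 ≤ μ ω) (X : Ω → A) (Y : Ω → B) (Z : Ω → C) :
    rvEntropy μ (fun ω => (X ω, Y ω, Z ω)) + rvEntropy μ Z ≤
      rvEntropy μ (fun ω => (X ω, Z ω)) + rvEntropy μ (fun ω => (Y ω, Z ω)) := by
  have hlog : 0 < Real.log 2 := Real.log_pos one_lt_two
  refine le_of_mul_le_mul_right ?_ hlog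
  simp only [add_mul, rvEntropy_mul_log, Fintype.sum_prod_type]
  have h1 : ∀ a c, rvLaw μ (fun ω => (X ω, Z ω)) (a, c) =
      ∑ b, rvLaw μ (fun ω => (X ω, Y ω, Z ω)) (a, b, c) := by
    intro a c
    rw [rvLaw_fst_marginal μ Y]
    refine Finset.sum_congr rfl fun b _ => ?_
    simp only [rvLaw, Prod.mk.injEq]
    refine Finset.sum_congr rfl fun ω _ => if_congr (by tauto) rfl rfl
  have h2 : ∀ b c, rvLaw μ (fun ω => (Y ω, Z ω)) (b, c) =
      ∑ a, rvLaw μ (fun ω => (X ω, Y ω, Z ω)) (a, b, c) := fun b c =>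
    rvLaw_fst_marginal μ X (fun ω => (Y ω, Z ω)) (b, c)
  have h3 : ∀ c, rvLaw μ Z c = ∑ a, ∑ b, rvLaw μ (fun ω => (X ω, Y ω, Z ω)) (a, b, c) := by
    intro c
    rw [rvLaw_fst_marginal μ X]
    simp only [h1]
  simp only [h1, h2, h3]
  have key := Finset.sum_le_sum fun c (_ : c ∈ Finset.univ) => sum_negMulLog_add_le
    (fun a b => rvLaw μ (fun ω => (X ω, Y ω, Z ω)) (a, b, c)) (fun a b => rvLaw_nonneg hμ _ _)
  simp only [Finset.sum_add_distrib] at key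
  have s1 : ∑ a, ∑ b, ∑ c, Real.negMulLog (rvLaw μ (fun ω => (X ω, Y ω, Z ω)) (a, b, c)) =
      ∑ c, ∑ a, ∑ b, Real.negMulLog (rvLaw μ (fun ω => (X ω, Y ω, Z ω)) (a, b, c)) := by
    rw [Finset.sum_comm]
    simp_rw [Finset.sum_comm (s := (Finset.univ : Finset C))]
    rw [Finset.sum_comm]
  rw [s1]
  refine key.trans (le_of_eq ?_)
  congr 1 <;> exact Finset.sum_comm

/-- Conditioning on `Y` leaves less entropy than conditioning on a function `Z` of `Y`. -/
theorem rvEntropy_cond_mono {μ : Ω → ℝ} (hμ : ∀ ω, 0 ≤ μ ω) (X : Ω → A) {Y : Ω → B} {Z : Ω → C}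
    (h : ∀ ω ω', Y ω = Y ω' → Z ω = Z ω') :
    rvEntropy μ (fun ω => (X ω, Y ω)) - rvEntropy μ Y ≤
      rvEntropy μ (fun ω => (X ω, Z ω)) - rvEntropy μ Z := by
  have h1 := rvEntropy_submodular hμ X Y Z
  have h2 : rvEntropy μ (fun ω => (X ω, Y ω, Z ω)) = rvEntropy μ (fun ω => (X ω, Y ω)) :=
    rvEntropy_congr fun ω ω' _ _ => by
      simp only [Prod.mk.injEq]
      exact ⟨fun h => ⟨h.1, h.2.1⟩, fun k => ⟨k.1, k.2, h _ _ k.2⟩⟩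
  have h3 : rvEntropy μ (fun ω => (Y ω, Z ω)) = rvEntropy μ Y :=
    rvEntropy_congr fun ω ω' _ _ => by
      simp only [Prod.mk.injEq]
      exact ⟨fun h => h.1, fun k => ⟨k, h _ _ k⟩⟩
  linarith

theorem rvEntropy_const {μ : Ω → ℝ} (hμ : ∑ ω, μ ω = 1) {X : Ω → A} (h : ∀ ω ω', X ω = X ω') :
    rvEntropy μ X = 0 := by
  have h1 : rvEntropy μ X = rvEntropy μ (fun _ => ()) :=
    rvEntropy_congr fun ω ω' _ _ => by simp [h ω ω']
  rw [h1]
  simp [rvEntropy, rvLaw, hμ]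

theorem rvEntropy_subadditive {μ : Ω → ℝ} (hμ : ∀ ω, 0 ≤ μ ω) (hμ1 : ∑ ω, μ ω = 1)
    (X : Ω → A) (Y : Ω → B) :
    rvEntropy μ (fun ω => (X ω, Y ω)) ≤ rvEntropy μ X + rvEntropy μ Y := by
  have h := rvEntropy_cond_mono hμ X (Y := Y) (Z := fun _ => ()) fun _ _ _ => rfl
  have h1 : rvEntropy μ (fun ω => (X ω, ())) = rvEntropy μ X :=
    rvEntropy_congr fun ω ω' _ _ => by simp
  rw [h1, rvEntropy_const hμ1 (X := fun _ => ()) fun _ _ => rfl] at h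
  linarith

/-- An entropy with a component `v` splits into the entropies of the slices. -/
theorem rvEntropy_slices (ν : D × Ω → ℝ) (X : Ω → A) :
    rvEntropy ν (fun z => (z.1, X z.2)) = ∑ v, rvEntropy (fun ω => ν (v, ω)) X := by
  simp only [rvEntropy, Fintype.sum_prod_type]
  refine Finset.sum_congr rfl fun v _ => Finset.sum_congr rfl fun a _ => ?_
  congr 2
  simp only [rvLaw, Fintype.sum_prod_type]
  rw [Finset.sum_eq_single v]
  · simp
  · intro v' _ hv'
    simp [hv']
  · simp

theorem rvLaw_slices (ν : D × Ω → ℝ) (X : Ω → A) :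
    rvLaw ν (fun z => X z.2) = rvLaw (fun ω => ∑ v, ν (v, ω)) X := by
  ext a
  simp only [rvLaw, Fintype.sum_prod_type]
  rw [Finset.sum_comm]
  refine Finset.sum_congr rfl fun ω _ => ?_
  split_ifs <;> simp

theorem rvLaw_smul (c : ℝ) (μ : Ω → ℝ) (X : Ω → A) (a : A) :
    rvLaw (fun ω => c * μ ω) X a = c * rvLaw μ X a := by
  simp [rvLaw, Finset.mul_sum]

/-- The correction term does not depend on `X`, so it cancels in every difference of two entropies
under one law. -/
theorem rvEntropy_smul (c : ℝ) (μ : Ω → ℝ) (X : Ω → A) :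
    rvEntropy (fun ω => c * μ ω) X =
      c * rvEntropy μ X + (∑ ω, μ ω) * Real.negMulLog c / Real.log 2 := by
  simp only [rvEntropy, rvLaw_smul, Real.negMulLog_mul]
  rw [← sum_rvLaw μ X, Finset.mul_sum, Finset.sum_mul, Finset.sum_div, ← Finset.sum_add_distrib]
  refine Finset.sum_congr rfl fun a _ => by ring

theorem rvLaw_sum_mul {ι : Type*} [Fintype ι] (c : ι → ℝ) (μ : ι → Ω → ℝ) (X : Ω → A) (a : A) :
    rvLaw (fun ω => ∑ i, c i * μ i ω) X a = ∑ i, c i * rvLaw (μ i) X a := by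
  simp only [rvLaw, Finset.mul_sum]
  rw [Finset.sum_comm]
  refine Finset.sum_congr rfl fun ω _ => ?_
  split_ifs <;> simp

/-- Entropy is a concave function of the law. -/
theorem sum_mul_rvEntropy_le {ι : Type*} [Fintype ι] {c : ι → ℝ} (hc : ∀ i, 0 ≤ c i)
    (hc1 : ∑ i, c i = 1) {μ : ι → Ω → ℝ} (hμ : ∀ i ω, 0 ≤ μ i ω) (X : Ω → A) :
    ∑ i, c i * rvEntropy (μ i) X ≤ rvEntropy (fun ω => ∑ i, c i * μ i ω) X := by
  refine le_of_mul_le_mul_right ?_ (Real.log_pos one_lt_two)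
  rw [Finset.sum_mul]
  simp only [mul_assoc, rvEntropy_mul_log, Finset.mul_sum]
  rw [Finset.sum_comm]
  refine Finset.sum_le_sum fun a _ => ?_
  have := Real.concaveOn_negMulLog.le_map_sum (t := Finset.univ) (w := c)
    (p := fun i => rvLaw (μ i) X a) (fun i _ => hc i) hc1 (fun i _ => rvLaw_nonneg (hμ i) X a)
  simp only [smul_eq_mul] at this
  exact this.trans_eq (congrArg _ (rvLaw_sum_mul c μ X a).symm)

/-- Fano's inequality. -/
theorem rvEntropy_fano {μ : Ω → ℝ} (hμ : ∀ ω, 0 ≤ μ ω) (hμ1 : ∑ ω, μ ω = 1) {M : ℕ}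
    (X : Ω → Fin M) (Y : Ω → B) (ψ : B → Fin M) :
    rvEntropy μ (fun ω => (X ω, Y ω)) - rvEntropy μ Y ≤
      1 + (∑ ω, if ψ (Y ω) ≠ X ω then μ ω else 0) * (Real.log M / Real.log 2) := by
  have hlog : 0 < Real.log 2 := Real.log_pos one_lt_two
  obtain ⟨ω₀⟩ : Nonempty Ω := by
    by_contra h
    rw [not_nonempty_iff] at h
    simp at hμ1
  have hM : 0 < (M : ℝ) := by exact_mod_cast (X ω₀).pos
  -- Reference kernel for Gibbs' inequality: half of the mass on the decoder's guess, half uniform.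
  -- Thus `-log r` is at most `log 2` on a correct guess and equals `log 2 + log M` on an error.
  set r : Fin M → B → ℝ := fun w y => (if ψ y = w then 1 else 0) / 2 + 1 / (2 * M) with hr
  have hr0 : ∀ w y, 0 < r w y := fun w y => by
    have : (0 : ℝ) ≤ if ψ y = w then 1 else 0 := by split_ifs <;> norm_num
    positivity
  have hr1 : ∀ y, ∑ w, r w y = 1 := fun y => by
    simp only [hr, Finset.sum_add_distrib, ← Finset.sum_div]
    simp
    field_simp
    norm_num
  have gibbs := sum_mul_log_le_sum_mul_log (A := Fin M × B)
    (p := rvLaw μ (fun ω => (X ω, Y ω))) (q := fun x => rvLaw μ Y x.2 * r x.1 x.2)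
    (fun x => rvLaw_nonneg hμ _ _) (fun x => mul_nonneg (rvLaw_nonneg hμ _ _) (hr0 _ _).le)
    (by
      rintro ⟨w, y⟩ h
      have h0 : rvLaw μ Y y = 0 := (mul_eq_zero.1 h).resolve_right (hr0 _ _).ne'
      rw [rvLaw_fst_marginal μ X, Finset.sum_eq_zero_iff_of_nonneg
        (fun a _ => rvLaw_nonneg hμ _ _)] at h0
      exact h0 w (Finset.mem_univ _))
    (by
      rw [sum_rvLaw, Fintype.sum_prod_type_right, ← sum_rvLaw μ Y]
      refine Finset.sum_le_sum fun y _ => ?_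
      exact (by rw [← Finset.mul_sum, hr1, mul_one] :
        ∑ w, rvLaw μ Y y * r w y = rvLaw μ Y y).le)
  rw [sum_rvLaw_mul, sum_rvLaw_mul] at gibbs
  rw [rvEntropy_eq_expectation, rvEntropy_eq_expectation, ← sub_div, div_le_iff₀ hlog]
  have hterm : ∀ ω, μ ω * Real.log (rvLaw μ Y (Y ω)) - μ ω * Real.log 2 -
      (if ψ (Y ω) ≠ X ω then μ ω else 0) * Real.log M ≤
      μ ω * Real.log (rvLaw μ Y (Y ω) * r (X ω) (Y ω)) := by
    intro ω
    rcases (hμ ω).eq_or_lt with h0 | h0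
    · simp [← h0]
    have hY : 0 < rvLaw μ Y (Y ω) := by
      have := Finset.single_le_sum (f := fun ω' => if Y ω' = Y ω then μ ω' else 0)
        (fun ω' _ => by split_ifs <;> simp [hμ ω']) (Finset.mem_univ ω)
      simp only [if_true] at this
      exact h0.trans_le this
    rw [Real.log_mul hY.ne' (hr0 _ _).ne', mul_add]
    have hb : -(μ ω * Real.log 2) - (if ψ (Y ω) ≠ X ω then μ ω else 0) * Real.log M ≤
        μ ω * Real.log (r (X ω) (Y ω)) := by
      by_cases h : ψ (Y ω) = X ω
      · have : Real.log (1 / 2) ≤ Real.log (r (X ω) (Y ω)) := by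
          refine Real.log_le_log (by norm_num) ?_
          simp only [hr, h, if_true]
          have : (0 : ℝ) ≤ 1 / (2 * M) := by positivity
          linarith
        rw [one_div, Real.log_inv] at this
        have := mul_le_mul_of_nonneg_left this h0.le
        simp [h]
        linarith
      · have : Real.log (r (X ω) (Y ω)) = -Real.log 2 - Real.log M := by
          simp only [hr, h, if_false]
          rw [zero_div, zero_add, one_div, Real.log_inv, Real.log_mul (by norm_num) hM.ne']
          ring
        rw [this]
        simp [h]
        linarith
    linarith
  have hsum := Finset.sum_le_sum fun ω (_ : ω ∈ Finset.univ) => hterm ω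
  simp only [Finset.sum_sub_distrib, ← Finset.sum_mul, hμ1] at hsum
  rw [add_mul, mul_assoc, div_mul_cancel₀ _ hlog.ne']
  linarith

end Information

/-! ### Kernels, random functions and the conic Carathéodory theorem. -/

open scoped Classical in
/-- A nonnegative vector is its total mass times a probability vector. -/
theorem exists_stdSimplex_mul {A : Type*} [Fintype A] [Nonempty A] {a : A → ℝ}
    (ha : ∀ x, 0 ≤ a x) : ∃ κ ∈ stdSimplex ℝ A, ∀ x, a x = (∑ y, a y) * κ x := by
  rcases eq_or_ne (∑ y, a y) 0 with h | h
  · refine ⟨Pi.single (Classical.arbitrary A) 1, single_mem_stdSimplex ℝ _, fun x => ?_⟩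
    rw [h, zero_mul]
    exact (Finset.sum_eq_zero_iff_of_nonneg fun y _ => ha y).1 h x (Finset.mem_univ x)
  · refine ⟨fun x => a x / ∑ y, a y, ⟨fun x => div_nonneg (ha x)
      (Finset.sum_nonneg fun y _ => ha y), ?_⟩, fun x => ?_⟩
    · rw [← Finset.sum_div, div_self h]
    · field_simp

/-- The product measure on functions has the prescribed one-point marginals. -/
theorem sum_prod_kernel_eq {A B : Type*} [Fintype A] [Fintype B] [DecidableEq A] [DecidableEq B]
    {κ : A → B → ℝ}
    (hκ : ∀ a, κ a ∈ stdSimplex ℝ B) (a₀ : A) (b₀ : B) :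
    ∑ f : A → B, (∏ a, κ a (f a)) * (if b₀ = f a₀ then 1 else 0) = κ a₀ b₀ := by
  -- The indicator is absorbed into the factor at `a₀`, so the sum over functions factors and every
  -- other factor sums to one.
  have h := Finset.prod_univ_sum (fun _ : A => (Finset.univ : Finset B))
    (fun a b => κ a b * if a = a₀ then (if b₀ = b then 1 else 0) else 1)
  rw [Fintype.piFinset_univ] at h
  simp only [Finset.prod_mul_distrib, Finset.prod_ite_eq', Finset.mem_univ, if_true] at h
  rw [← h, Finset.prod_eq_single a₀]
  · simp
  · intro a _ ha
    simpa [ha] using (hκ a).2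
  · simp

/-- Conic Carathéodory theorem with a linear objective: a conic combination of vectors in `ℝ^K`
can be rewritten with at most `|K|` of them without decreasing the objective. -/
theorem exists_conic_combination_card_le {J K : Type*} [Fintype J] [Fintype K]
    {r : J → K → ℝ} (hr : ∀ j k, 0 ≤ r j k) {g : J → ℝ} (hg : ∀ j, r j = 0 → g j = 0)
    {c : J → ℝ} (hc : ∀ j, 0 ≤ c j) :
    ∃ c' : J → ℝ, (∀ j, 0 ≤ c' j) ∧ ∑ j, c' j • r j = ∑ j, c j • r j ∧
      ∑ j, c j * g j ≤ ∑ j, c' j * g j ∧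
      (Finset.univ.filter fun j => c' j ≠ 0).card ≤ Fintype.card K := by
  classical
  induction hN : (Finset.univ.filter fun j => c j ≠ 0).card using Nat.strong_induction_on
    generalizing c with
  | _ N ih =>
  set s := Finset.univ.filter fun j => c j ≠ 0 with hs
  by_cases hli : LinearIndependent ℝ fun j : s => r j
  · refine ⟨c, hc, rfl, le_rfl, ?_⟩
    have := hli.fintype_card_le_finrank
    simpa using this
  obtain ⟨e, he, j₀, hj₀⟩ := Fintype.not_linearIndependent_iff.1 hli
  set d₀ : J → ℝ := fun j => if h : j ∈ s then e ⟨j, h⟩ else 0 with hd₀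
  have hd₀s : ∀ j, j ∉ s → d₀ j = 0 := fun j h => by simp [hd₀, h]
  have hd₀r : ∑ j, d₀ j • r j = 0 := by
    rw [← he, ← Finset.sum_subset (Finset.subset_univ s), ← Finset.sum_coe_sort s]
    · refine Finset.sum_congr rfl fun j _ => ?_
      simp [hd₀]
    · intro j _ hj
      simp [hd₀s j hj]
  have hd₀ne : d₀ j₀ ≠ 0 := by simpa [hd₀] using hj₀
  -- A nonnegative relation between nonnegative vectors involves only zero vectors, on which `g`
  -- vanishes.
  have hsign : ∀ d : J → ℝ, (∀ j, 0 ≤ d j) → ∑ j, d j • r j = 0 → ∑ j, d j * g j = 0 := by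
    intro d hd hdr
    refine Finset.sum_eq_zero fun j _ => ?_
    rcases eq_or_ne (d j) 0 with h | h
    · simp [h]
    rw [hg j, mul_zero]
    ext k
    have := congrFun hdr k
    simp only [Finset.sum_apply, Pi.smul_apply, smul_eq_mul, Pi.zero_apply] at this
    have := (Finset.sum_eq_zero_iff_of_nonneg fun j _ => mul_nonneg (hd j) (hr j k)).1 this j
      (Finset.mem_univ j)
    exact (mul_eq_zero.1 this).resolve_left h
  -- A direction along which the combination is constant and the objective does not decrease. Its
  -- negative coordinate ensures that moving along it reaches the boundary of the orthant; if `d₀`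
  -- has a single sign, `hsign` allows either orientation.
  obtain ⟨d, hds, hdr, hdg, j₁, hj₁⟩ : ∃ d : J → ℝ, (∀ j, j ∉ s → d j = 0) ∧
      ∑ j, d j • r j = 0 ∧ 0 ≤ ∑ j, d j * g j ∧ ∃ j, d j < 0 := by
    have hneg : ∑ j, (-d₀ j) • r j = 0 := by simp [hd₀r]
    have hnegs : ∀ j, j ∉ s → -d₀ j = 0 := fun j h => by simp [hd₀s j h]
    by_cases hp : ∀ j, 0 ≤ d₀ j
    · refine ⟨fun j => -d₀ j, hnegs, hneg, ?_, j₀, ?_⟩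
      · simp [hsign d₀ hp hd₀r]
      · simpa using (hp j₀).lt_of_ne' hd₀ne
    by_cases hm : ∀ j, 0 ≤ -d₀ j
    · push Not at hp
      refine ⟨d₀, hd₀s, hd₀r, ?_, hp⟩
      have := hsign _ hm hneg
      simp only [neg_mul, Finset.sum_neg_distrib, neg_eq_zero] at this
      exact this.ge
    push Not at hp hm
    rcases le_total 0 (∑ j, d₀ j * g j) with h | h
    · exact ⟨d₀, hd₀s, hd₀r, h, hp⟩
    · exact ⟨fun j => -d₀ j, hnegs, hneg, by simpa using h, hm⟩
  set n := Finset.univ.filter fun j => d j < 0 with hn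
  have hnne : n.Nonempty := ⟨j₁, by simp [hn, hj₁]⟩
  obtain ⟨j₂, hj₂, hmin⟩ := n.exists_min_image (fun j => c j / -d j) hnne
  have hj₂' : d j₂ < 0 := by simpa [hn] using hj₂
  -- The longest step that keeps all coefficients nonnegative; it annihilates the coefficient at
  -- `j₂` and so shrinks the support.
  set t := c j₂ / -d j₂ with ht
  have ht0 : 0 ≤ t := div_nonneg (hc _) (by linarith)
  have hc'0 : ∀ j, 0 ≤ c j + t * d j := by
    intro j
    rcases lt_or_ge (d j) 0 with h | h
    · have h1 := hmin j (by simp [hn, h])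
      rw [le_div_iff₀ (by linarith)] at h1
      linarith
    · exact add_nonneg (hc j) (mul_nonneg ht0 h)
  have hj₂s : j₂ ∈ s := by
    by_contra h
    rw [hds _ h] at hj₂'
    exact lt_irrefl _ hj₂'
  have hz : c j₂ + t * d j₂ = 0 := by
    rw [ht]
    field_simp [hj₂'.ne]
    ring
  obtain ⟨c', h0, h1, h2, h3⟩ := ih _ (by
    rw [← hN]
    refine Finset.card_lt_card ?_
    refine Finset.ssubset_iff_of_subset ?_ |>.2 ⟨j₂, hj₂s, by simp [hz]⟩
    intro j hj
    by_contra h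
    have hcj : c j = 0 := by simpa [hs] using h
    simp [hcj, hds j h] at hj) hc'0 rfl
  refine ⟨c', h0, ?_, ?_, h3⟩
  · rw [h1]
    simp only [add_smul, Finset.sum_add_distrib, mul_smul, ← Finset.smul_sum, hdr]
    simp
  · refine le_trans ?_ h2
    simp only [add_mul, Finset.sum_add_distrib, mul_assoc, ← Finset.mul_sum]
    have := mul_nonneg ht0 hdg
    linarith

/-! ### From mixtures of input laws to test laws with small alphabets. -/

namespace StateRelayChannel

variable {S X₁ X₂ Y₂ Y₃ : Type*}
  [Fintype S] [Fintype X₁] [Fintype X₂] [Fintype Y₂] [Fintype Y₃]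
  (ch : StateRelayChannel S X₁ X₂ Y₂ Y₃)

/-- The joint law of `((S, X₁, X₂), (Y₂, Y₃))` when `a` is the (possibly unnormalised) law of
`(S, X₁, X₂)`. -/
def joint (a : S × X₁ × X₂ → ℝ) : (S × X₁ × X₂) × (Y₂ × Y₃) → ℝ :=
  fun z => a z.1 * ch.W z.1.2.1 z.1.2.2 z.1.1 z.2

/-- `I(X₁; Y₂, Y₃ | S, X₂)` as a function of the law of `(S, X₁, X₂)`. -/
def broadcastTerm (a : S × X₁ × X₂ → ℝ) : ℝ :=
  rvEntropy (ch.joint a) (fun z => (z.2, z.1.1, z.1.2.2)) -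
      rvEntropy (ch.joint a) (fun z => (z.1.1, z.1.2.2)) -
    (rvEntropy (ch.joint a) (fun z => z) - rvEntropy (ch.joint a) Prod.fst)

/-- `H(S) - H(Y₃)` as a function of the (possibly unnormalised) law of `(S, X₁, X₂)`. -/
def entropyGap (a : S × X₁ × X₂ → ℝ) : ℝ :=
  rvEntropy (ch.joint a) (fun z => z.1.1) - rvEntropy (ch.joint a) (fun z => z.2.2)

variable {ch}

theorem W_nonneg (x₁ : X₁) (x₂ : X₂) (s : S) (y : Y₂ × Y₃) : 0 ≤ ch.W x₁ x₂ s y :=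
  (ch.W_mem x₁ x₂ s).1 y

theorem joint_nonneg {a : S × X₁ × X₂ → ℝ} (ha : ∀ k, 0 ≤ a k) (z) : 0 ≤ ch.joint a z :=
  mul_nonneg (ha _) (W_nonneg _ _ _ _)

theorem sum_joint_right (a : S × X₁ × X₂ → ℝ) (k) : ∑ y, ch.joint a (k, y) = a k := by
  simp only [joint, ← Finset.mul_sum]
  rw [(ch.W_mem _ _ _).2, mul_one]

theorem joint_sum_mul {J : Type*} [Fintype J] (c : J → ℝ) (r : J → S × X₁ × X₂ → ℝ) (z) :
    ch.joint (fun k => ∑ j, c j * r j k) z = ∑ j, c j * ch.joint (r j) z := by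
  simp [joint, Finset.sum_mul, mul_assoc]

theorem joint_sum {J : Type*} [Fintype J] (r : J → S × X₁ × X₂ → ℝ) (z) :
    ch.joint (fun k => ∑ j, r j k) z = ∑ j, ch.joint (r j) z := by
  simp [joint, Finset.sum_mul]

theorem rvLaw_joint_comp_fst {A : Type*} (a : S × X₁ × X₂ → ℝ) (X : S × X₁ × X₂ → A) :
    rvLaw (ch.joint a) (fun z => X z.1) = rvLaw a X := by
  ext x
  simp only [rvLaw, Fintype.sum_prod_type (f := fun z : (S × X₁ × X₂) × (Y₂ × Y₃) => ite _ _ _)]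
  refine Finset.sum_congr rfl fun k _ => ?_
  split_ifs
  · exact sum_joint_right a k
  · simp

theorem rvEntropy_joint_comp_fst {A : Type*} [Fintype A] (a : S × X₁ × X₂ → ℝ)
    (X : S × X₁ × X₂ → A) : rvEntropy (ch.joint a) (fun z => X z.1) = rvEntropy a X := by
  simp only [rvEntropy, rvLaw_joint_comp_fst]

/-- The conditional entropy of the channel outputs given all inputs is linear in the input law. -/
theorem rvEntropy_joint_sub (a : S × X₁ × X₂ → ℝ) :
    rvEntropy (ch.joint a) (fun z => z) - rvEntropy (ch.joint a) Prod.fst =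
      ∑ k : S × X₁ × X₂,
        a k * ((∑ y, Real.negMulLog (ch.W k.2.1 k.2.2 k.1 y)) / Real.log 2) := by
  have h := rvEntropy_joint_comp_fst (ch := ch) a fun k => k
  change rvEntropy (ch.joint a) Prod.fst = _ at h
  rw [h]
  simp only [rvEntropy, rvLaw_id]
  rw [Fintype.sum_prod_type, ← Finset.sum_sub_distrib]
  refine Finset.sum_congr rfl fun k _ => ?_
  rw [← Finset.sum_div, ← sub_div, ← mul_div_assoc]
  congr 1
  simp only [joint, Real.negMulLog_mul, Finset.sum_add_distrib, ← Finset.mul_sum, ← Finset.sum_mul]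
  rw [(ch.W_mem _ _ _).2]
  ring

theorem rvEntropy_joint_sub_sum_mul {J : Type*} [Fintype J] (c : J → ℝ)
    (r : J → S × X₁ × X₂ → ℝ) :
    rvEntropy (ch.joint fun k => ∑ j, c j * r j k) (fun z => z) -
        rvEntropy (ch.joint fun k => ∑ j, c j * r j k) Prod.fst =
      ∑ j, c j * (rvEntropy (ch.joint (r j)) (fun z => z) -
        rvEntropy (ch.joint (r j)) Prod.fst) := by
  simp only [rvEntropy_joint_sub, Finset.sum_mul, Finset.mul_sum]
  rw [Finset.sum_comm]
  simp only [mul_assoc]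

/-- Homogeneity of degree one: both entropies acquire the same mass correction. Weights can
therefore be absorbed into unnormalised slices. -/
theorem entropyGap_smul (c : ℝ) (a : S × X₁ × X₂ → ℝ) :
    ch.entropyGap (fun k => c * a k) = c * ch.entropyGap a := by
  have : ch.joint (fun k => c * a k) = fun z => c * ch.joint a z := by
    ext z; simp [joint, mul_assoc]
  simp only [entropyGap, this, rvEntropy_smul]
  ring

open scoped Classical in
/-- A law of `(S, X₁, X₂)` is a mixture of laws under which `X₁` is a function of `(S, X₂)`, and
the mixture can be chosen so that the entropy gap does not decrease on average. -/
theorem exists_deterministic_mixture [Nonempty X₁] {r : S × X₁ × X₂ → ℝ} (hr : ∀ k, 0 ≤ r k) :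
    ∃ (p : (S × X₂ → X₁) → ℝ) (r' : (S × X₂ → X₁) → S × X₁ × X₂ → ℝ),
      (∀ f, 0 ≤ p f) ∧ (∀ f k, 0 ≤ r' f k) ∧
      (∀ f s x₁ x₂, r' f (s, x₁, x₂) ≠ 0 → x₁ = f (s, x₂)) ∧
      (∀ k, ∑ f, p f * r' f k = r k) ∧
      ch.entropyGap r ≤ ∑ f, p f * ch.entropyGap (r' f) := by
  -- `κ a` is the conditional law of `X₁` given `(S, X₂) = a`. Drawing the values `f a`
  -- independently from these laws gives the random function `f` with law `p`.
  choose κ hκ hκr using fun a : S × X₂ =>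
    exists_stdSimplex_mul (a := fun x₁ => r (a.1, x₁, a.2)) fun x₁ => hr _
  set p : (S × X₂ → X₁) → ℝ := fun f => ∏ a, κ a (f a) with hp
  set m : S × X₂ → ℝ := fun a => ∑ x₁, r (a.1, x₁, a.2) with hm
  set r' : (S × X₂ → X₁) → S × X₁ × X₂ → ℝ :=
    fun f k => m (k.1, k.2.2) * if k.2.1 = f (k.1, k.2.2) then 1 else 0 with hr'
  have hp0 : ∀ f, 0 ≤ p f := fun f => Finset.prod_nonneg fun a _ => (hκ a).1 _
  have hm0 : ∀ a, 0 ≤ m a := fun a => Finset.sum_nonneg fun x₁ _ => hr _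
  have hr'0 : ∀ f k, 0 ≤ r' f k := fun f k => by
    simp only [hr']; split_ifs <;> simp [hm0]
  have hp1 : ∑ f, p f = 1 := by
    have := Finset.prod_univ_sum (fun _ : S × X₂ => (Finset.univ : Finset X₁)) κ
    rw [Fintype.piFinset_univ] at this
    simp only [hp]
    rw [← this]
    exact Finset.prod_eq_one fun a _ => (hκ a).2
  have hmix : ∀ k, ∑ f, p f * r' f k = r k := by
    rintro ⟨s, x₁, x₂⟩
    have h1 := sum_prod_kernel_eq hκ (s, x₂) x₁
    have h2 := hκr (s, x₂) x₁
    simp only at h2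
    rw [h2, ← h1, Finset.mul_sum]
    refine Finset.sum_congr rfl fun f _ => ?_
    simp only [hr', hm, hp]
    ring
  refine ⟨p, r', hp0, hr'0, fun f s x₁ x₂ h => ?_, hmix, ?_⟩
  · by_contra hne
    simp [hr', hne] at h
  -- Fixing `f` leaves the law of `(S, X₂)` unchanged, so the gap varies only through `H(Y₃)`, which
  -- is concave.
  have hS : ∀ f, rvEntropy (ch.joint (r' f)) (fun z => z.1.1) =
      rvEntropy (ch.joint r) (fun z => z.1.1) := by
    intro f
    rw [rvEntropy_joint_comp_fst (r' f) Prod.fst, rvEntropy_joint_comp_fst r Prod.fst]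
    simp only [rvEntropy]
    refine Finset.sum_congr rfl fun s _ => ?_
    congr 2
    simp only [rvLaw, Fintype.sum_prod_type]
    refine Finset.sum_congr rfl fun s' _ => ?_
    rcases eq_or_ne s' s with rfl | hne
    · simp only [if_true]
      rw [Finset.sum_comm, Finset.sum_comm (f := fun x₁ x₂ => r (s', x₁, x₂))]
      refine Finset.sum_congr rfl fun x₂ _ => ?_
      simp [hr', hm]
    · simp [hne]
  have hY := sum_mul_rvEntropy_le hp0 hp1 (fun f => joint_nonneg (ch := ch) (hr'0 f))
    (fun z => z.2.2)
  have hj : (fun z => ∑ f, p f * ch.joint (r' f) z) = ch.joint r := by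
    ext z
    rw [← joint_sum_mul]
    simp only [hmix]
  rw [hj] at hY
  simp only [entropyGap, mul_sub, Finset.sum_sub_distrib, hS, ← Finset.sum_mul, hp1, one_mul]
  linarith


open scoped Classical in
/-- The test law in which `U` encodes `(S, X₂)`: the law of the coordinates when `(V, S, X₁, X₂)`
has law `r` and the outputs are those of the channel. -/
theorem isTestLaw_of_state_input [Nonempty X₁] {U V V' : Type*} [Fintype U] [Fintype V]
    [Fintype V'] [Nonempty V] [Nonempty X₂] (eU : S × X₂ ≃ U) (eV : V' ≃ V)
    {r : V' → S × X₁ × X₂ → ℝ} (hr : ∀ v k, 0 ≤ r v k)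
    (hQ : ∀ s, ∑ v, ∑ x₁, ∑ x₂, r v (s, x₁, x₂) = ch.Q s) :
    ch.IsTestLaw (rvLaw (fun z : V' × (S × X₁ × X₂) × (Y₂ × Y₃) => ch.joint (r z.1) z.2)
      (fun z => (z.2.1.1, eU (z.2.1.1, z.2.1.2.2), eV z.1, z.2.1.2.1, z.2.1.2.2, z.2.2))) := by
  -- `κ` is the law of `X₂` given `S`, and `l` the law of `(V, X₁)` given `(S, X₂)`.
  choose κ hκ hκr using fun s : S => exists_stdSimplex_mul
    (a := fun x₂ : X₂ => ∑ v, ∑ x₁, r v (s, x₁, x₂))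
    fun x₂ => Finset.sum_nonneg fun v _ => Finset.sum_nonneg fun x₁ _ => hr v _
  choose l hl hlr using fun a : S × X₂ => exists_stdSimplex_mul
    (a := fun b : V × X₁ => r (eV.symm b.1) (a.1, b.2, a.2)) fun b => hr _ _
  have hm : ∀ s x₂, ∑ v, ∑ x₁, r v (s, x₁, x₂) = ch.Q s * κ s x₂ := by
    intro s x₂
    rw [hκr s x₂, ← hQ s]
    congr 1
    rw [Finset.sum_comm]
    refine Finset.sum_congr rfl fun v _ => ?_
    rw [Finset.sum_comm]
  have hm' : ∀ s v x₁ x₂, r v (s, x₁, x₂) = ch.Q s * κ s x₂ * l (s, x₂) (eV v, x₁) := by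
    intro s v x₁ x₂
    have h := hlr (s, x₂) (eV v, x₁)
    simp only [Equiv.symm_apply_apply, Fintype.sum_prod_type] at h
    rw [h, ← hm]
    congr 1
    exact Equiv.sum_comp eV.symm fun v => ∑ x₁, r v (s, x₁, x₂)
  -- `U` copies `s` and draws `x₂` from `κ s`. The relay input is read off `U`, and the kernel of
  -- `(V, X₁)` may use `x₂` through `U`; this is why the product form costs nothing.
  refine ⟨fun s u => if (eU.symm u).1 = s then κ s (eU.symm u).2 else 0,
    fun u _ => Pi.single (eU.symm u).2 1, fun u s => l (s, (eU.symm u).2), ?_,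
    fun u s => single_mem_stdSimplex ℝ _, fun u s => hl _, ?_⟩
  · refine fun s => ⟨fun u => ?_, ?_⟩
    · dsimp only
      split_ifs
      exacts [(hκ s).1 _, le_rfl]
    · rw [Equiv.sum_comp eU.symm (fun a => if a.1 = s then κ s a.2 else 0),
        Fintype.sum_prod_type, Finset.sum_comm]
      simpa using (hκ s).2
  · intro s u v x₁ x₂ y₂ y₃
    obtain ⟨⟨s', x₂'⟩, rfl⟩ := eU.surjective u
    obtain ⟨v, rfl⟩ := eV.surjective v
    rw [rvLaw, Finset.sum_eq_single (v, (s, x₁, x₂), (y₂, y₃))]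
    · simp only [Prod.mk.injEq, EmbeddingLike.apply_eq_iff_eq, true_and, and_true, joint, hm',
        Equiv.symm_apply_apply, Pi.single_apply]
      by_cases h1 : s = s'
      · subst h1
        by_cases h2 : x₂ = x₂'
        · subst h2
          simp
        · simp [h2]
      · simp [h1, Ne.symm h1]
    · rintro ⟨v', ⟨s'', x₁'', x₂''⟩, y'⟩ _ hne
      rw [if_neg]
      simp only [Prod.mk.injEq, EmbeddingLike.apply_eq_iff_eq] at hne ⊢
      rintro ⟨rfl, -, rfl, rfl, rfl, rfl⟩
      simp at hne
    · simp

/-- A variable that ignores `V` sees only the sum of the slices, and `joint` is additive. -/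
theorem rvEntropy_joint_family {V A : Type*} [Fintype V] [Fintype A] (r : V → S × X₁ × X₂ → ℝ)
    (X : (S × X₁ × X₂) × (Y₂ × Y₃) → A) :
    rvEntropy (fun z : V × (S × X₁ × X₂) × (Y₂ × Y₃) => ch.joint (r z.1) z.2) (fun z => X z.2) =
      rvEntropy (ch.joint fun k => ∑ v, r v k) X := by
  have : (ch.joint fun k => ∑ v, r v k) = fun z => ∑ v, ch.joint (r v) z := by
    ext z; exact joint_sum r z
  simp only [rvEntropy, rvLaw_slices, this]

/-- When `U` encodes `(S, X₂)` and `X₁` is a function of `(V, S, X₂)`, the objective is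
`min {I(X₁; Y₂, Y₃ | S, X₂), I(V; Y₃) - I(V; S)}`. -/
theorem boundObjective_of_deterministic {U V V' : Type*} [Fintype U] [Fintype V]
    [Fintype V'] (eU : S × X₂ ≃ U) (eV : V' ≃ V)
    {r : V' → S × X₁ × X₂ → ℝ} {f : V' → S × X₂ → X₁}
    (hf : ∀ v s x₁ x₂, r v (s, x₁, x₂) ≠ 0 → x₁ = f v (s, x₂)) :
    boundObjective
      (rvLaw (fun z : V' × (S × X₁ × X₂) × (Y₂ × Y₃) => ch.joint (r z.1) z.2)
        (fun z => (z.2.1.1, eU (z.2.1.1, z.2.1.2.2), eV z.1, z.2.1.2.1, z.2.1.2.2, z.2.2))) =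
      min (ch.broadcastTerm fun k => ∑ v, r v k)
        (∑ v, ch.entropyGap (r v) - ch.entropyGap fun k => ∑ v, r v k) := by
  set ν : V' × (S × X₁ × X₂) × (Y₂ × Y₃) → ℝ := fun z => ch.joint (r z.1) z.2 with hν
  have hνr : ∀ z, ν z ≠ 0 → z.2.1.2.1 = f z.1 (z.2.1.1, z.2.1.2.2) := by
    rintro ⟨v, ⟨s, x₁, x₂⟩, y⟩ h
    exact hf v s x₁ x₂ (left_ne_zero_of_mul h)
  simp only [boundObjective, rvCondMutualInfo, rvMutualInfo, rvCondEntropy, rvEntropy_rvLaw, rvV,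
    rvY₂Y₃, rvUX₂, rvS, rvY₃]
  congr 1
  · have e1 : rvEntropy ν (fun z => (z.2.2, eU (z.2.1.1, z.2.1.2.2), z.2.1.2.2)) =
        rvEntropy ν (fun z => (z.2.2, z.2.1.1, z.2.1.2.2)) :=
      rvEntropy_congr fun z z' _ _ => by
        simp only [Prod.mk.injEq, EmbeddingLike.apply_eq_iff_eq]; tauto
    have e2 : rvEntropy ν (fun z => (z.2.1.1, eU (z.2.1.1, z.2.1.2.2), z.2.1.2.2)) =
        rvEntropy ν (fun z => (z.2.1.1, z.2.1.2.2)) :=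
      rvEntropy_congr fun z z' _ _ => by
        simp only [Prod.mk.injEq, EmbeddingLike.apply_eq_iff_eq]; tauto
    -- On the support `X₁` is determined by `(V, S, X₂)`, so it can be inserted without changing the
    -- entropy.
    have e3 : rvEntropy ν (fun z => (eV z.1, z.2.2, eU (z.2.1.1, z.2.1.2.2), z.2.1.2.2)) =
        rvEntropy ν (fun z => (z.1, z.2)) :=
      rvEntropy_congr fun ⟨v, ⟨s, x₁, x₂⟩, y⟩ ⟨v', ⟨s', x₁', x₂'⟩, y'⟩ hz hz' => by
        have h := hνr _ hz
        have h' := hνr _ hz'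
        simp only [Prod.mk.injEq, EmbeddingLike.apply_eq_iff_eq] at h h' ⊢
        constructor
        · rintro ⟨rfl, rfl, ⟨rfl, rfl⟩, -⟩
          simp [h, h']
        · tauto
    have e4 : rvEntropy ν (fun z => (eV z.1, z.2.1.1, eU (z.2.1.1, z.2.1.2.2), z.2.1.2.2)) =
        rvEntropy ν (fun z => (z.1, z.2.1)) :=
      rvEntropy_congr fun ⟨v, ⟨s, x₁, x₂⟩, y⟩ ⟨v', ⟨s', x₁', x₂'⟩, y'⟩ hz hz' => by
        have h := hνr _ hz
        have h' := hνr _ hz'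
        simp only [Prod.mk.injEq, EmbeddingLike.apply_eq_iff_eq] at h h' ⊢
        constructor
        · rintro ⟨rfl, rfl, ⟨-, rfl⟩, -⟩
          simp [h, h']
        · tauto
    have e5 := rvEntropy_joint_family (ch := ch) r fun z => (z.2, z.1.1, z.1.2.2)
    have e6 := rvEntropy_joint_family (ch := ch) r fun z => (z.1.1, z.1.2.2)
    have e7 := rvEntropy_slices ν fun z => z
    have e8 := rvEntropy_slices ν fun z => z.1
    -- Given all inputs, `V` has no effect on the outputs: their conditional entropy is linear in
    -- the input law, so the slices add up to its value at the sum.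
    have e9 := rvEntropy_joint_sub_sum_mul (ch := ch) (fun _ => 1) r
    simp only [one_mul, Finset.sum_sub_distrib] at e9
    change _ = _ - ∑ j, rvEntropy (ch.joint (r j)) (fun z => z.1) at e9
    rw [e1, e2, e3, e4, e5, e6, e7, e8, broadcastTerm, e9]
    ring
  · have e1 : rvEntropy ν (fun z => (eV z.1, z.2.2.2)) = rvEntropy ν (fun z => (z.1, z.2.2.2)) :=
      rvEntropy_congr fun z z' _ _ => by
        simp only [Prod.mk.injEq, EmbeddingLike.apply_eq_iff_eq]
    have e2 : rvEntropy ν (fun z => (eV z.1, z.2.1.1)) = rvEntropy ν (fun z => (z.1, z.2.1.1)) :=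
      rvEntropy_congr fun z z' _ _ => by
        simp only [Prod.mk.injEq, EmbeddingLike.apply_eq_iff_eq]
    have e3 := rvEntropy_slices ν fun z => z.2.2
    have e4 := rvEntropy_slices ν fun z => z.1.1
    have e5 := rvEntropy_joint_family (ch := ch) r fun z => z.2.2
    have e6 := rvEntropy_joint_family (ch := ch) r fun z => z.1.1
    rw [e1, e2, e3, e4, e5, e6]
    simp only [entropyGap, Finset.sum_sub_distrib]
    ring

/-- Every mixture of laws of `(S, X₁, X₂)` with the right state marginal is dominated by a test law
with small auxiliary alphabets. -/
theorem exists_mem_boundValues [Nonempty X₁] [Nonempty X₂] {J : Type*} [Fintype J] {c : J → ℝ}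
    (hc : ∀ j, 0 ≤ c j) {r : J → S × X₁ × X₂ → ℝ} (hr : ∀ j k, 0 ≤ r j k)
    (hQ : ∀ s, ∑ x₁, ∑ x₂, ∑ j, c j * r j (s, x₁, x₂) = ch.Q s) :
    ∃ ρ ∈ ch.boundValues, min (ch.broadcastTerm fun k => ∑ j, c j * r j k)
      (∑ j, c j * ch.entropyGap (r j) - ch.entropyGap fun k => ∑ j, c j * r j k) ≤ ρ := by
  classical
  choose p r' hp hr' hdet hmix hgap using fun j => exists_deterministic_mixture (ch := ch) (hr j)
  -- The new `V` is the pair of the old index and the random function. Preserving the law of `(S,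
  -- X₁, X₂)` imposes one linear constraint per triple; the total mass needs no separate constraint.
  obtain ⟨w, hw, hwr, hwg, hcard⟩ := exists_conic_combination_card_le
    (J := J × (S × X₂ → X₁)) (r := fun z => r' z.1 z.2) (fun z k => hr' _ _ _)
    (g := fun z => ch.entropyGap (r' z.1 z.2)) (fun z hz => by
      have : ch.joint (r' z.1 z.2) = fun _ => 0 := by
        ext; simp [joint, hz]
      simp [entropyGap, this, rvEntropy, rvLaw]) (c := fun z => c z.1 * p z.1 z.2)
    (fun z => mul_nonneg (hc _) (hp _ _))
  set V' := {z : J × (S × X₂ → X₁) // w z ≠ 0} with hV'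
  set R : V' → S × X₁ × X₂ → ℝ := fun v k => w v.1 * r' v.1.1 v.1.2 k with hR
  have hsub : ∀ F : J × (S × X₂ → X₁) → ℝ, ∑ v : V', w v.1 * F v.1 = ∑ z, w z * F z := by
    intro F
    rw [← Finset.sum_subtype (Finset.univ.filter fun z => w z ≠ 0) (by simp)
      (fun z => w z * F z), Finset.sum_filter]
    refine Finset.sum_congr rfl fun z _ => ?_
    split_ifs with h
    · rfl
    · rw [not_not.1 h, zero_mul]
  have hsum : (fun k => ∑ v, R v k) = fun k => ∑ j, c j * r j k := by
    ext k
    have := congrFun hwr k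
    simp only [Finset.sum_apply, Pi.smul_apply, smul_eq_mul] at this
    rw [hsub fun z => r' z.1 z.2 k, this, Fintype.sum_prod_type]
    refine Finset.sum_congr rfl fun j _ => ?_
    rw [← hmix j k, Finset.mul_sum]
    simp only [mul_assoc]
  have hg : ∑ j, c j * ch.entropyGap (r j) ≤ ∑ v, ch.entropyGap (R v) := by
    simp only [hR, entropyGap_smul]
    rw [hsub fun z => ch.entropyGap (r' z.1 z.2)]
    refine le_trans ?_ hwg
    rw [Fintype.sum_prod_type]
    refine Finset.sum_le_sum fun j _ => ?_
    simp only [mul_assoc, ← Finset.mul_sum]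
    exact mul_le_mul_of_nonneg_left (hgap j) (hc j)
  have hR0 : ∀ v k, 0 ≤ R v k := fun v k => mul_nonneg (hw _) (hr' _ _ _)
  have hRQ : ∀ s, ∑ v, ∑ x₁, ∑ x₂, R v (s, x₁, x₂) = ch.Q s := by
    intro s
    rw [← hQ s, Finset.sum_comm]
    refine Finset.sum_congr rfl fun x₁ _ => ?_
    rw [Finset.sum_comm]
    exact Finset.sum_congr rfl fun x₂ _ => congrFun hsum _
  have hV'ne : Nonempty V' := by
    by_contra h
    rw [not_nonempty_iff] at h
    have h1 := ch.Q_mem.2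
    simp only [← hRQ, Finset.univ_eq_empty, Finset.sum_empty, Finset.sum_const_zero] at h1
    exact zero_ne_one h1
  have hV'card : Fintype.card V' ≤ Fintype.card (S × X₁ × X₂) := by
    rwa [Fintype.card_subtype]
  have : Nonempty (Fin (Fintype.card V')) := ⟨⟨0, Fintype.card_pos⟩⟩
  -- `|U| = |S| |X₂|` and `|V| ≤ |S| |X₁| |X₂|`, within the permitted sizes.
  refine ⟨_, ⟨Fintype.card (S × X₂), Fintype.card V', ?_, ?_, _,
    isTestLaw_of_state_input (Fintype.equivFin _) (Fintype.equivFin V') hR0 hRQ, rfl⟩, ?_⟩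
  · rw [Fintype.card_prod]
    have : 0 < Fintype.card X₁ := Fintype.card_pos
    nlinarith [Nat.zero_le (Fintype.card S * Fintype.card X₂)]
  · simp only [Fintype.card_prod, ← mul_assoc] at hV'card
    exact hV'card.trans (Nat.le_self_pow two_ne_zero _)
  · rw [boundObjective_of_deterministic _ _ (f := fun v => v.1.2)
      (fun v s x₁ x₂ h => hdet _ _ _ _ _ (right_ne_zero_of_mul h)), hsum]
    exact min_le_min le_rfl (sub_le_sub_right hg _)

end StateRelayChannel

/-! ### Causal products of kernels, and sequences with hidden entries. -/

/-- The first `i` entries of a sequence. -/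
def seqPast {T : Type*} {n : ℕ} (i : Fin n) (y : Fin n → T) : Fin (i : ℕ) → T :=
  fun j => y (Fin.castLE i.isLt.le j)

/-- A sequence whose entries are drawn one after the other from kernels which see the past: the
total mass is one, and the `i`-th entry has the `i`-th kernel as its conditional law. -/
theorem sum_prod_causal {T : Type*} [Fintype T] : ∀ (n : ℕ)
    (k : (i : Fin n) → (Fin (i : ℕ) → T) → T → ℝ) (_ : ∀ i p, ∑ t, k i p t = 1),
    (∑ y : Fin n → T, ∏ i, k i (seqPast i y) (y i) = 1) ∧
    ∀ (i : Fin n) (F : (Fin (i : ℕ) → T) → T → ℝ),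
      ∑ y : Fin n → T, (∏ j, k j (seqPast j y) (y j)) * F (seqPast i y) (y i) =
      ∑ y : Fin n → T, (∏ j, k j (seqPast j y) (y j)) *
        ∑ t, k i (seqPast i y) t * F (seqPast i y) t
  | 0, _, _ => ⟨by simp, fun i => i.elim0⟩
  | n + 1, k, hk => by
    obtain ⟨ih1, ih2⟩ := sum_prod_causal n (fun i => k i.castSucc) fun i p => hk i.castSucc p
    have hsum : ∀ G : (Fin (n + 1) → T) → ℝ,
        ∑ y, G y = ∑ y : Fin n → T, ∑ t, G (Fin.snoc y t) := by
      intro G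
      rw [← (Fin.snocEquiv fun _ => T).sum_comp, Fintype.sum_prod_type_right]
      rfl
    have hpast : ∀ (i : Fin n) (y : Fin n → T) (t : T),
        seqPast i.castSucc (Fin.snoc y t : Fin (n + 1) → T) = seqPast i y := by
      intro i y t
      ext j
      exact Fin.snoc_castSucc (α := fun _ => T) t y (Fin.castLE i.isLt.le j)
    have hlast : ∀ (y : Fin n → T) (t : T),
        seqPast (Fin.last n) (Fin.snoc y t : Fin (n + 1) → T) = y := by
      intro y t
      ext j
      exact Fin.snoc_castSucc (α := fun _ => T) t y j
    have hprod : ∀ (y : Fin n → T) (t : T),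
        ∏ j, k j (seqPast j (Fin.snoc y t : Fin (n + 1) → T)) ((Fin.snoc y t : Fin (n + 1) → T) j) =
          (∏ j, k (Fin.castSucc j) (seqPast j y) (y j)) * k (Fin.last n) y t := by
      intro y t
      rw [Fin.prod_univ_castSucc]
      simp only [hpast, hlast, Fin.snoc_castSucc, Fin.snoc_last]
    refine ⟨?_, fun i => ?_⟩
    · rw [hsum]
      simp only [hprod, ← Finset.mul_sum]
      rw [← ih1]
      exact Finset.sum_congr rfl fun y _ => by rw [hk (Fin.last n) y, mul_one]
    · induction i using Fin.lastCases with
      | last =>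
        intro F
        rw [hsum, hsum]
        simp only [hprod, hlast, Fin.snoc_last]
        refine Finset.sum_congr rfl fun y _ => ?_
        simp only [mul_assoc, ← Finset.mul_sum, ← Finset.sum_mul]
        congr 1
        rw [hk (Fin.last n) y, one_mul]
      | cast i =>
        intro F
        rw [hsum, hsum]
        simp only [hprod, hpast, Fin.snoc_castSucc]
        have h1 : ∀ y : Fin n → T, ∀ G : ℝ,
            ∑ t, (∏ j, k (Fin.castSucc j) (seqPast j y) (y j)) * k (Fin.last n) y t * G =
            (∏ j, k (Fin.castSucc j) (seqPast j y) (y j)) * G := by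
          intro y G
          rw [← Finset.sum_mul, ← Finset.mul_sum, hk (Fin.last n) y, mul_one]
        simp only [h1]
        exact ih2 i F

/-- The first `i` entries of a sequence, the others being hidden. -/
def maskPast {T : Type*} {n : ℕ} (i : ℕ) (y : Fin n → T) : Fin n → Option T :=
  fun j => if j.val < i then some (y j) else none

/-- The entries of a sequence from `i` on, the others being hidden. -/
def maskFuture {T : Type*} {n : ℕ} (i : ℕ) (y : Fin n → T) : Fin n → Option T :=
  fun j => if i ≤ j.val then some (y j) else none

section Masks

variable {T : Type*} {n : ℕ} {y y' : Fin n → T}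

theorem maskPast_eq_iff {i : ℕ} :
    maskPast i y = maskPast i y' ↔ ∀ j : Fin n, j.val < i → y j = y' j := by
  simp only [funext_iff, maskPast]
  refine forall_congr' fun j => ?_
  by_cases h : j.val < i <;> simp [h]

theorem maskFuture_eq_iff {i : ℕ} :
    maskFuture i y = maskFuture i y' ↔ ∀ j : Fin n, i ≤ j.val → y j = y' j := by
  simp only [funext_iff, maskFuture]
  refine forall_congr' fun j => ?_
  by_cases h : i ≤ j.val <;> simp [h]

theorem maskPast_zero_eq : maskPast 0 y = maskPast 0 y' := by
  simp [maskPast_eq_iff]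

theorem maskPast_length_eq_iff : maskPast n y = maskPast n y' ↔ y = y' := by
  rw [maskPast_eq_iff, funext_iff]
  exact forall_congr' fun j => by simp

theorem maskPast_succ_eq_iff (i : Fin n) :
    maskPast (i + 1) y = maskPast (i + 1) y' ↔ y i = y' i ∧ maskPast i y = maskPast i y' := by
  simp only [maskPast_eq_iff]
  constructor
  · exact fun h => ⟨h i (Nat.lt_succ_self _), fun j hj => h j (hj.trans (Nat.lt_succ_self _))⟩
  · rintro ⟨h1, h2⟩ j hj
    rcases (Nat.lt_succ_iff_lt_or_eq.1 hj) with h | h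
    · exact h2 j h
    · rw [Fin.ext h]; exact h1

theorem maskFuture_zero_eq_iff : maskFuture 0 y = maskFuture 0 y' ↔ y = y' := by
  rw [maskFuture_eq_iff, funext_iff]
  exact forall_congr' fun j => by simp

theorem maskFuture_length_eq : maskFuture n y = maskFuture n y' := by
  rw [maskFuture_eq_iff]
  intro j hj
  exact absurd j.isLt (not_lt.2 hj)

theorem maskFuture_eq_iff_succ (i : Fin n) :
    maskFuture i y = maskFuture i y' ↔
      y i = y' i ∧ maskFuture (i + 1) y = maskFuture (i + 1) y' := by
  simp only [maskFuture_eq_iff]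
  constructor
  · exact fun h => ⟨h i le_rfl, fun j hj => h j (by omega)⟩
  · rintro ⟨h1, h2⟩ j hj
    rcases hj.eq_or_lt with h | h
    · rw [← Fin.ext h]; exact h1
    · exact h2 j h

end Masks

/-! ### Time sharing: dependence of the two terms on the input law. -/

namespace StateRelayChannel

variable {S X₁ X₂ Y₂ Y₃ : Type*}
  [Fintype S] [Fintype X₁] [Fintype X₂] [Fintype Y₂] [Fintype Y₃]
  {ch : StateRelayChannel S X₁ X₂ Y₂ Y₃}

/-- `I(X₁; Y₂, Y₃ | S, X₂)` is a concave function of the input law. -/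
theorem sum_mul_broadcastTerm_le {J : Type*} [Fintype J] {c : J → ℝ} (hc : ∀ j, 0 ≤ c j)
    {r : J → S × X₁ × X₂ → ℝ} (hr : ∀ j k, 0 ≤ r j k) :
    ∑ j, c j * ch.broadcastTerm (r j) ≤ ch.broadcastTerm fun k => ∑ j, c j * r j k := by
  have hj : ∀ j, ch.joint (fun k => c j * r j k) = fun z => c j * ch.joint (r j) z := fun j => by
    ext z; simp [joint, mul_assoc]
  set ν : J × (S × X₁ × X₂) × (Y₂ × Y₃) → ℝ :=
    fun z => ch.joint (fun k => c z.1 * r z.1 k) z.2 with hν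
  have hν0 : ∀ z, 0 ≤ ν z := fun z =>
    joint_nonneg (fun k => mul_nonneg (hc _) (hr _ _)) _
  -- The index `j` acts as a time-sharing variable, and dropping it from the conditioning can only
  -- raise the output entropy. The subtracted entropy given all inputs is linear in the law, hence
  -- unaffected.
  have h := rvEntropy_cond_mono hν0 (fun z => z.2.2) (Y := fun z => (z.1, z.2.1.1, z.2.1.2.2))
    (Z := fun z => (z.2.1.1, z.2.1.2.2)) fun z z' h => (Prod.ext_iff.1 h).2
  have e1 : rvEntropy ν (fun z => (z.2.2, z.1, z.2.1.1, z.2.1.2.2)) =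
      rvEntropy ν (fun z => (z.1, z.2.2, z.2.1.1, z.2.1.2.2)) :=
    rvEntropy_congr fun z z' _ _ => by simp only [Prod.mk.injEq]; tauto
  have e2 := rvEntropy_slices ν fun z => (z.2, z.1.1, z.1.2.2)
  have e3 := rvEntropy_slices ν fun z => (z.1.1, z.1.2.2)
  have e4 := rvEntropy_joint_family (ch := ch) (fun j k => c j * r j k)
    fun z => (z.2, z.1.1, z.1.2.2)
  have e5 := rvEntropy_joint_family (ch := ch) (fun j k => c j * r j k)
    fun z => (z.1.1, z.1.2.2)
  rw [e1, e2, e3, e4, e5] at h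
  simp only [hν, hj, rvEntropy_smul, Finset.sum_add_distrib] at h
  simp only [broadcastTerm, rvEntropy_joint_sub_sum_mul, mul_sub, Finset.sum_sub_distrib]
  linarith

/-- `H(S) - H(Y₃)` is a convex function of the input law as long as the law of `S` is fixed. -/
theorem entropyGap_sum_mul_le {J : Type*} [Fintype J] {c : J → ℝ} (hc : ∀ j, 0 ≤ c j)
    (hc1 : ∑ j, c j = 1) {q : J → S × X₁ × X₂ → ℝ} (hq : ∀ j k, 0 ≤ q j k)
    (hQ : ∀ j, rvLaw (q j) Prod.fst = ch.Q) :
    ch.entropyGap (fun k => ∑ j, c j * q j k) ≤ ∑ j, c j * ch.entropyGap (q j) := by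
  have hY := sum_mul_rvEntropy_le hc hc1 (fun j => joint_nonneg (ch := ch) (hq j))
    (fun z => z.2.2)
  have hj : (fun z => ∑ j, c j * ch.joint (q j) z) = ch.joint fun k => ∑ j, c j * q j k := by
    ext z
    rw [joint_sum_mul]
  rw [hj] at hY
  have hS : ∀ a : S × X₁ × X₂ → ℝ, rvLaw a Prod.fst = ch.Q →
      rvEntropy (ch.joint a) (fun z => z.1.1) = rvEntropy ch.Q (fun s => s) := by
    intro a ha
    rw [rvEntropy_joint_comp_fst a Prod.fst]
    simp only [rvEntropy, ha, rvLaw_id]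
  have hm : rvLaw (fun k => ∑ j, c j * q j k) Prod.fst = ch.Q := by
    ext s
    rw [rvLaw_sum_mul]
    simp only [hQ]
    rw [← Finset.sum_mul, hc1, one_mul]
  simp only [entropyGap, hS _ (hQ _), hS _ hm, mul_sub, Finset.sum_sub_distrib, ← Finset.sum_mul,
    hc1]
  linarith

end StateRelayChannel

/-! ### The law of message, states and outputs induced by a code. -/

theorem log_prod_of_ne_zero_mul {ι : Type*} [Fintype ι] {f : ι → ℝ} {c : ℝ}
    (h : c * ∏ i, f i ≠ 0) :
    Real.log (c * ∏ i, f i) = Real.log c + ∑ i, Real.log (f i) := by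
  rw [Real.log_mul (left_ne_zero_of_mul h) (right_ne_zero_of_mul h),
    Real.log_prod fun i hi => Finset.prod_ne_zero_iff.1 (right_ne_zero_of_mul h) i hi]

namespace StateRelayChannel

variable {S X₁ X₂ Y₂ Y₃ : Type*}
  [Fintype S] [Fintype X₁] [Fintype X₂] [Fintype Y₂] [Fintype Y₃]
  {ch : StateRelayChannel S X₁ X₂ Y₂ Y₃} {M n : ℕ}

variable {M n : ℕ}

/-- The sample space of a code: message, states, outputs. -/
abbrev CodeSpace (S Y₂ Y₃ : Type*) (M n : ℕ) : Type _ :=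
  Fin M × (Fin n → S) × (Fin n → Y₂ × Y₃)

/-- The law of message, states and outputs on `CodeSpace`. -/
def codePmf (ch : StateRelayChannel S X₁ X₂ Y₂ Y₃) (c : RelayCode S X₁ X₂ Y₂ Y₃ M n)
    (ω : CodeSpace S Y₂ Y₃ M n) : ℝ :=
  ch.codeLaw c ω.1 ω.2.1 (fun i => (ω.2.2 i).1) (fun i => (ω.2.2 i).2)

/-- State and inputs at time `i`. -/
def codeInput (c : RelayCode S X₁ X₂ Y₂ Y₃ M n) (i : Fin n) (ω : CodeSpace S Y₂ Y₃ M n) :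
    S × X₁ × X₂ :=
  (ω.2.1 i, c.source ω.1 ω.2.1 i, relayInput c (fun j => (ω.2.2 j).1) i)

/-- The law of the outputs at time `i` given the past. -/
def codeKernel (ch : StateRelayChannel S X₁ X₂ Y₂ Y₃) (c : RelayCode S X₁ X₂ Y₂ Y₃ M n)
    (w : Fin M) (s : Fin n → S) (i : Fin n) (p : Fin (i : ℕ) → Y₂ × Y₃) : Y₂ × Y₃ → ℝ :=
  ch.W (c.source w s i) (c.relay i fun j => (p j).1) (s i)

variable (c : RelayCode S X₁ X₂ Y₂ Y₃ M n)

theorem sum_codeKernel (w : Fin M) (s : Fin n → S) (i : Fin n) (p) :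
    ∑ t, ch.codeKernel c w s i p t = 1 :=
  (ch.W_mem _ _ _).2

theorem codePmf_eq (w : Fin M) (s : Fin n → S) (y : Fin n → Y₂ × Y₃) :
    ch.codePmf c (w, s, y) = (1 / (M : ℝ) * ∏ i, ch.Q (s i)) *
      ∏ i, ch.codeKernel c w s i (seqPast i y) (y i) := by
  rw [codePmf, codeLaw, Finset.prod_mul_distrib, ← mul_assoc]
  rfl

theorem codePmf_nonneg (ω) : 0 ≤ ch.codePmf c ω :=
  mul_nonneg (by positivity) (Finset.prod_nonneg fun i _ =>
    mul_nonneg (ch.Q_mem.1 _) (W_nonneg _ _ _ _))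

/-- The outputs sum out because, given message and states, they form a causal product of normalised
kernels. -/
theorem sum_codePmf_mul (G : Fin M → (Fin n → S) → ℝ) :
    ∑ ω, ch.codePmf c ω * G ω.1 ω.2.1 =
      ∑ w, ∑ s : Fin n → S, (1 / (M : ℝ) * ∏ i, ch.Q (s i)) * G w s := by
  rw [Fintype.sum_prod_type]
  refine Finset.sum_congr rfl fun w _ => ?_
  rw [Fintype.sum_prod_type]
  refine Finset.sum_congr rfl fun s _ => ?_
  simp only [codePmf_eq]
  rw [← Finset.sum_mul, ← Finset.mul_sum,
    (sum_prod_causal n (ch.codeKernel c w s) (sum_codeKernel c w s)).1, mul_one]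

/-- Conditional law of the outputs at time `i`. The test function may see the whole state sequence,
future included, as the auxiliary variable of the converse requires. -/
theorem sum_codePmf_mul_output (i : Fin n)
    (F : Fin M → (Fin n → S) → (Fin (i : ℕ) → Y₂ × Y₃) → Y₂ × Y₃ → ℝ) :
    ∑ ω, ch.codePmf c ω * F ω.1 ω.2.1 (seqPast i ω.2.2) (ω.2.2 i) =
      ∑ ω, ch.codePmf c ω * ∑ t, ch.codeKernel c ω.1 ω.2.1 i (seqPast i ω.2.2) t *
        F ω.1 ω.2.1 (seqPast i ω.2.2) t := by
  rw [Fintype.sum_prod_type, Fintype.sum_prod_type]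
  refine Finset.sum_congr rfl fun w _ => ?_
  rw [Fintype.sum_prod_type, Fintype.sum_prod_type]
  refine Finset.sum_congr rfl fun s _ => ?_
  simp only [codePmf_eq, mul_assoc, ← Finset.mul_sum]
  rw [(sum_prod_causal n (ch.codeKernel c w s) (sum_codeKernel c w s)).2 i (F w s)]

open scoped Classical in
/-- Given a variable `V` which depends on message, states and past outputs only, and given the
inputs and the state at time `i`, the outputs at time `i` have the law of the channel. -/
theorem rvLaw_codePmf_output {D : Type*} [Fintype D] (i : Fin n)
    (V : Fin M → (Fin n → S) → (Fin (i : ℕ) → Y₂ × Y₃) → D) (v : D) :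
    (fun z => rvLaw (ch.codePmf c)
      (fun ω => (V ω.1 ω.2.1 (seqPast i ω.2.2), codeInput c i ω, ω.2.2 i)) (v, z)) =
      ch.joint fun k => rvLaw (ch.codePmf c)
        (fun ω => (V ω.1 ω.2.1 (seqPast i ω.2.2), codeInput c i ω)) (v, k) := by
  ext ⟨k, t⟩
  have h := sum_codePmf_mul_output (ch := ch) c i fun w s p t' =>
    if (V w s p, ((s i, c.source w s i, c.relay i fun j => (p j).1) : S × X₁ × X₂), t') =
      (v, k, t) then 1 else 0
  rw [rvLaw_eq_sum_mul, joint, rvLaw_eq_sum_mul, Finset.sum_mul]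
  refine h.trans (Finset.sum_congr rfl fun ω _ => ?_)
  rw [mul_assoc]
  congr 1
  rw [Finset.sum_eq_single t]
  · change _ = (if (V ω.1 ω.2.1 (seqPast i ω.2.2), ((ω.2.1 i, c.source ω.1 ω.2.1 i,
      c.relay i fun j => (seqPast i ω.2.2 j).1) : S × X₁ × X₂)) = (v, k) then 1 else 0) * _
    by_cases hv : (V ω.1 ω.2.1 (seqPast i ω.2.2), ((ω.2.1 i, c.source ω.1 ω.2.1 i,
      c.relay i fun j => (seqPast i ω.2.2 j).1) : S × X₁ × X₂)) = (v, k)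
    · have := (Prod.ext_iff.1 hv).2
      simp only at this
      rw [if_pos hv, ← this, if_pos]
      · simp [codeKernel]
      · simp only [Prod.mk.injEq] at hv ⊢
        simp [hv.1]
    · rw [if_neg hv, if_neg]
      · simp
      · simp only [Prod.mk.injEq] at hv ⊢
        tauto
  · intro t' _ ht
    simp [ht]
  · simp

theorem rvLaw_codePmf_joint (i : Fin n) :
    rvLaw (ch.codePmf c) (fun ω => (codeInput c i ω, ω.2.2 i)) =
      ch.joint (rvLaw (ch.codePmf c) (codeInput c i)) := by
  have h := rvLaw_codePmf_output (ch := ch) c i (fun _ _ _ => ()) ()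
  have h1 := rvLaw_comp_injective (ch.codePmf c) (fun ω => (codeInput c i ω, ω.2.2 i))
    (Prod.mk_right_injective ())
  have h2 := rvLaw_comp_injective (ch.codePmf c) (codeInput c i) (Prod.mk_right_injective ())
  simp only [h1, h2] at h
  exact h

/-- An i.i.d. law is a causal product whose kernels ignore the past. -/
theorem sum_prod_Q_mul (i : Fin n) (F : S → ℝ) :
    ∑ s : Fin n → S, (∏ j, ch.Q (s j)) * F (s i) = ∑ a, ch.Q a * F a := by
  have h := sum_prod_causal n (fun _ _ => ch.Q) fun _ _ => ch.Q_mem.2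
  rw [h.2 i fun _ => F, ← Finset.sum_mul, h.1, one_mul]

theorem sum_codePmf (hM : 0 < M) : ∑ ω, ch.codePmf c ω = 1 := by
  have h := sum_codePmf_mul (ch := ch) c fun _ _ => 1
  have hQ := (sum_prod_causal n (fun _ _ => ch.Q) fun _ _ => ch.Q_mem.2).1
  have hM' : (M : ℝ) ≠ 0 := by positivity
  simp only [mul_one, ← Finset.mul_sum] at h
  rw [h, hQ]
  simp [hM']

open scoped Classical in
theorem rvLaw_codePmf_state (hM : 0 < M) (i : Fin n) :
    rvLaw (ch.codePmf c) (fun ω => ω.2.1 i) = ch.Q := by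
  ext a
  have hM' : (M : ℝ) ≠ 0 := by positivity
  rw [rvLaw_eq_sum_mul, sum_codePmf_mul c fun _ s => if s i = a then 1 else 0]
  simp only [mul_assoc, ← Finset.mul_sum]
  rw [sum_prod_Q_mul i fun x => if x = a then 1 else 0]
  simp [hM']

open scoped Classical in
theorem rvLaw_codePmf_message_states (w : Fin M) (s : Fin n → S) :
    rvLaw (ch.codePmf c) (fun ω => (ω.1, ω.2.1)) (w, s) = 1 / (M : ℝ) * ∏ i, ch.Q (s i) := by
  rw [rvLaw_eq_sum_mul, sum_codePmf_mul c fun w' s' => if (w', s') = (w, s) then 1 else 0,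
    Finset.sum_eq_single w, Finset.sum_eq_single s]
  · simp
  · intro s' _ h; simp [h]
  · simp
  · intro w' _ h; simp [h]
  · simp

theorem rvLaw_codePmf_message (w : Fin M) :
    rvLaw (ch.codePmf c) (fun ω => ω.1) w = 1 / (M : ℝ) := by
  classical
  rw [rvLaw_eq_sum_mul, sum_codePmf_mul c fun w' _ => if w' = w then 1 else 0]
  have hQ := (sum_prod_causal n (fun _ _ => ch.Q) fun _ _ => ch.Q_mem.2).1
  simp only [← Finset.sum_mul, ← Finset.mul_sum]
  rw [hQ]
  simp

open scoped Classical in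
theorem rvLaw_codePmf_states (hM : 0 < M) (s : Fin n → S) :
    rvLaw (ch.codePmf c) (fun ω => ω.2.1) s = ∏ i, ch.Q (s i) := by
  have hM' : (M : ℝ) ≠ 0 := by positivity
  rw [rvLaw_eq_sum_mul, sum_codePmf_mul c fun _ s' => if s' = s then 1 else 0]
  simp [hM']

/-- Expectation of the log-likelihood of the state sequence. -/
theorem sum_codePmf_mul_sum_log (hM : 0 < M) :
    ∑ ω, ch.codePmf c ω * ∑ i, Real.log (ch.Q (ω.2.1 i)) =
      -(n * rvEntropy ch.Q (fun s => s) * Real.log 2) := by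
  simp only [Finset.mul_sum]
  rw [Finset.sum_comm]
  have : ∀ i, ∑ ω, ch.codePmf c ω * Real.log (ch.Q (ω.2.1 i)) =
      -(rvEntropy ch.Q (fun s => s) * Real.log 2) := by
    intro i
    rw [← sum_rvLaw_mul (ch.codePmf c) (fun ω => ω.2.1 i) fun a => Real.log (ch.Q a),
      rvLaw_codePmf_state c hM, rvEntropy_mul_log, rvLaw_id]
    simp [Real.negMulLog]
  simp only [this]
  simp [mul_assoc]

theorem rvEntropy_message (hM : 0 < M) :
    rvEntropy (ch.codePmf c) (fun ω => ω.1) = Real.log M / Real.log 2 := by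
  have hM' : (M : ℝ) ≠ 0 := by positivity
  rw [rvEntropy_eq_expectation]
  simp only [rvLaw_codePmf_message, ← Finset.sum_mul, sum_codePmf c hM]
  simp

theorem rvEntropy_states (hM : 0 < M) :
    rvEntropy (ch.codePmf c) (fun ω => ω.2.1) = n * rvEntropy ch.Q (fun s => s) := by
  have h2 : Real.log 2 ≠ 0 := (Real.log_pos one_lt_two).ne'
  have h : ∑ ω, ch.codePmf c ω * Real.log (rvLaw (ch.codePmf c) (fun ω => ω.2.1) ω.2.1) =
      ∑ ω, ch.codePmf c ω * ∑ i, Real.log (ch.Q (ω.2.1 i)) := by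
    refine Finset.sum_congr rfl fun ω _ => ?_
    rcases eq_or_ne (ch.codePmf c ω) 0 with h0 | h0
    · simp [h0]
    rw [rvLaw_codePmf_states c hM]
    rw [show ω = (ω.1, ω.2.1, ω.2.2) from rfl, codePmf_eq] at h0
    have h1 := right_ne_zero_of_mul (left_ne_zero_of_mul h0)
    rw [Real.log_prod fun i hi => Finset.prod_ne_zero_iff.1 h1 i hi]
  rw [rvEntropy_eq_expectation, h, sum_codePmf_mul_sum_log c hM]
  field_simp

theorem rvEntropy_message_states (hM : 0 < M) :
    rvEntropy (ch.codePmf c) (fun ω => (ω.1, ω.2.1)) =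
      rvEntropy (ch.codePmf c) (fun ω => ω.1) + rvEntropy (ch.codePmf c) (fun ω => ω.2.1) := by
  have h2 : Real.log 2 ≠ 0 := (Real.log_pos one_lt_two).ne'
  have h : ∑ ω, ch.codePmf c ω * Real.log (rvLaw (ch.codePmf c) (fun ω => (ω.1, ω.2.1))
      (ω.1, ω.2.1)) =
      ∑ ω, (ch.codePmf c ω * Real.log (1 / (M : ℝ)) +
        ch.codePmf c ω * ∑ i, Real.log (ch.Q (ω.2.1 i))) := by
    refine Finset.sum_congr rfl fun ω _ => ?_
    rcases eq_or_ne (ch.codePmf c ω) 0 with h0 | h0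
    · simp [h0]
    rw [rvLaw_codePmf_message_states c]
    rw [show ω = (ω.1, ω.2.1, ω.2.2) from rfl, codePmf_eq] at h0
    rw [log_prod_of_ne_zero_mul (left_ne_zero_of_mul h0), mul_add]
  rw [rvEntropy_eq_expectation, h, Finset.sum_add_distrib, ← Finset.sum_mul, sum_codePmf c hM,
    sum_codePmf_mul_sum_log c hM, rvEntropy_states c hM, rvEntropy_message c hM, one_div,
    Real.log_inv]
  field_simp
  ring

/-- Chain rule: given message and states, the channel is memoryless. -/
theorem rvEntropy_codePmf :
    rvEntropy (ch.codePmf c) (fun ω => ω) = rvEntropy (ch.codePmf c) (fun ω => (ω.1, ω.2.1)) +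
      ∑ i, (rvEntropy (ch.joint (rvLaw (ch.codePmf c) (codeInput c i))) (fun z => z) -
        rvEntropy (ch.joint (rvLaw (ch.codePmf c) (codeInput c i))) Prod.fst) := by
  have h2 : Real.log 2 ≠ 0 := (Real.log_pos one_lt_two).ne'
  -- The expected log-likelihood of one channel use depends only on the single-time law of inputs
  -- and outputs.
  have hW : ∀ i : Fin n, ∑ ω, ch.codePmf c ω * Real.log (ch.codeKernel c ω.1 ω.2.1 i
      (seqPast i ω.2.2) (ω.2.2 i)) =
      -((rvEntropy (ch.joint (rvLaw (ch.codePmf c) (codeInput c i))) (fun z => z) -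
        rvEntropy (ch.joint (rvLaw (ch.codePmf c) (codeInput c i))) Prod.fst) * Real.log 2) := by
    intro i
    have h := sum_rvLaw_mul (ch.codePmf c) (fun ω => (codeInput c i ω, ω.2.2 i))
      fun z => Real.log (ch.W z.1.2.1 z.1.2.2 z.1.1 z.2)
    rw [rvLaw_codePmf_joint] at h
    refine h.symm.trans ?_
    rw [rvEntropy_joint_sub, Fintype.sum_prod_type, Finset.sum_mul, ← Finset.sum_neg_distrib]
    refine Finset.sum_congr rfl fun k _ => ?_
    rw [mul_assoc, div_mul_cancel₀ _ h2, Finset.mul_sum, ← Finset.sum_neg_distrib]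
    refine Finset.sum_congr rfl fun t _ => ?_
    simp only [joint, Real.negMulLog]
    ring
  have h : ∑ ω, ch.codePmf c ω * Real.log (ch.codePmf c ω) =
      ∑ ω, (ch.codePmf c ω * Real.log (rvLaw (ch.codePmf c) (fun ω => (ω.1, ω.2.1))
        (ω.1, ω.2.1)) + ∑ i, ch.codePmf c ω * Real.log (ch.codeKernel c ω.1 ω.2.1 i
        (seqPast i ω.2.2) (ω.2.2 i))) := by
    refine Finset.sum_congr rfl fun ω _ => ?_
    rcases eq_or_ne (ch.codePmf c ω) 0 with h0 | h0
    · simp [h0]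
    rw [← Finset.mul_sum, ← mul_add, rvLaw_codePmf_message_states c]
    rw [show ω = (ω.1, ω.2.1, ω.2.2) from rfl, codePmf_eq] at h0 ⊢
    rw [log_prod_of_ne_zero_mul h0]
  rw [rvEntropy_eq_expectation, rvLaw_id, h, Finset.sum_add_distrib, Finset.sum_comm,
    rvEntropy_eq_expectation]
  simp only [hW]
  rw [Finset.sum_neg_distrib, ← Finset.sum_mul]
  field_simp
  ring

end StateRelayChannel

theorem Fin.sum_univ_sub_telescope (a : ℕ → ℝ) (n : ℕ) :
    ∑ i : Fin n, (a (i + 1) - a i) = a n - a 0 := by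
  rw [Fin.sum_univ_eq_sum_range (fun i => a (i + 1) - a i), Finset.sum_range_sub]

/-! ### The converse for a code of fixed length. -/

namespace StateRelayChannel

variable {S X₁ X₂ Y₂ Y₃ : Type*}
  [Fintype S] [Fintype X₁] [Fintype X₂] [Fintype Y₂] [Fintype Y₃]
  {ch : StateRelayChannel S X₁ X₂ Y₂ Y₃} {M n : ℕ}

/-- The output sequence of the destination. -/
def destOutput (ω : CodeSpace S Y₂ Y₃ M n) : Fin n → Y₃ := fun i => (ω.2.2 i).2

variable (c : RelayCode S X₁ X₂ Y₂ Y₃ M n)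

theorem errorProb_eq :
    ch.errorProb c = ∑ ω, if c.decoder (destOutput ω) ≠ ω.1 then ch.codePmf c ω else 0 := by
  rw [errorProb, Fintype.sum_prod_type]
  refine Finset.sum_congr rfl fun w _ => ?_
  rw [Fintype.sum_prod_type]
  refine Finset.sum_congr rfl fun s _ => ?_
  rw [← (Equiv.arrowProdEquivProdArrow (Fin n) (fun _ => Y₂) (fun _ => Y₃)).symm.sum_comp,
    Fintype.sum_prod_type]
  rfl

theorem rvEntropy_codePmf_joint {A : Type*} [Fintype A] (i : Fin n)
    (X : (S × X₁ × X₂) × (Y₂ × Y₃) → A) :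
    rvEntropy (ch.joint (rvLaw (ch.codePmf c) (codeInput c i))) X =
      rvEntropy (ch.codePmf c) (fun ω => X (codeInput c i ω, ω.2.2 i)) := by
  rw [← rvLaw_codePmf_joint, rvEntropy_rvLaw]

/-- The information which relay and destination together obtain about the message. -/
theorem message_info_le_sum_broadcastTerm (hM : 0 < M) :
    rvEntropy (ch.codePmf c) (fun ω => ω.1) + rvEntropy (ch.codePmf c) destOutput -
        rvEntropy (ch.codePmf c) (fun ω => (ω.1, destOutput ω)) ≤
      ∑ i, ch.broadcastTerm (rvLaw (ch.codePmf c) (codeInput c i)) := by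
  have hμ := codePmf_nonneg (ch := ch) c
  -- Genie argument: states and relay outputs are revealed to the destination, which can only lower
  -- the uncertainty about the message.
  have h1 := rvEntropy_cond_mono hμ (fun ω => ω.1) (Y := fun ω => ω.2) (Z := destOutput)
    fun ω ω' h => by ext1 j; simp only [destOutput, h]
  have h2 := rvEntropy_codePmf (ch := ch) c
  have h3 := rvEntropy_message_states (ch := ch) c hM
  -- Masks make sense for every natural number, including the endpoint `n`, so `a` can be
  -- telescoped.
  set a : ℕ → ℝ := fun i => rvEntropy (ch.codePmf c) (fun ω => (ω.2.1, maskPast i ω.2.2)) with ha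
  have ha0 : a 0 = rvEntropy (ch.codePmf c) (fun ω => ω.2.1) :=
    rvEntropy_congr fun ω ω' _ _ => by
      simp only [Prod.mk.injEq, and_iff_left_iff_imp]
      exact fun _ => maskPast_zero_eq
  have han : a n = rvEntropy (ch.codePmf c) (fun ω => ω.2) :=
    rvEntropy_congr fun ω ω' _ _ => by
      rw [Prod.mk.injEq, maskPast_length_eq_iff, Prod.ext_iff]
  have hstep : ∀ i : Fin n, a (i + 1) - a i ≤
      rvEntropy (ch.joint (rvLaw (ch.codePmf c) (codeInput c i)))
        (fun z => (z.2, z.1.1, z.1.2.2)) -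
      rvEntropy (ch.joint (rvLaw (ch.codePmf c) (codeInput c i))) (fun z => (z.1.1, z.1.2.2)) := by
    intro i
    rw [rvEntropy_codePmf_joint, rvEntropy_codePmf_joint]
    -- The relay input is a function of the past outputs, so conditioning on states and past is
    -- finer than on `(Sᵢ, X₂ᵢ)`. The source input depends on the message and cannot be included.
    have h := rvEntropy_cond_mono hμ (fun ω => ω.2.2 i)
      (Y := fun ω => (ω.2.1, maskPast i ω.2.2))
      (Z := fun ω => ((codeInput c i ω).1, (codeInput c i ω).2.2)) fun ω ω' h => by
        simp only [Prod.mk.injEq, maskPast_eq_iff] at h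
        simp only [codeInput, relayInput, h.1, Prod.mk.injEq, true_and]
        congr 1
        ext j
        rw [h.2 _ j.isLt]
    have e : a (i + 1) = rvEntropy (ch.codePmf c)
        (fun ω => (ω.2.2 i, ω.2.1, maskPast i ω.2.2)) :=
      rvEntropy_congr fun ω ω' _ _ => by
        simp only [Prod.mk.injEq, maskPast_succ_eq_iff]
        tauto
    rw [e]
    exact h
  have hsum := Finset.sum_le_sum fun i (_ : i ∈ Finset.univ) => hstep i
  rw [Fin.sum_univ_sub_telescope, ha0, han] at hsum
  simp only [broadcastTerm, Finset.sum_sub_distrib] at hsum h2 ⊢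
  linarith

/-- The auxiliary variable of the converse at time `i`: the message, the past outputs of the
destination and the future states. -/
def codeAux (i : Fin n) (ω : CodeSpace S Y₂ Y₃ M n) :
    Fin M × (Fin n → Option Y₃) × (Fin n → Option S) :=
  (ω.1, maskPast i (destOutput ω), maskFuture (i + 1) ω.2.1)

/-- Given the inputs at time `i`, the auxiliary variable does not affect the channel. -/
theorem rvLaw_codePmf_aux_joint (i : Fin n) (v) :
    (fun z => rvLaw (ch.codePmf c)
      (fun ω => (codeAux i ω, codeInput c i ω, ω.2.2 i)) (v, z)) =
      ch.joint fun k => rvLaw (ch.codePmf c) (fun ω => (codeAux i ω, codeInput c i ω)) (v, k) := by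
  have h := rvLaw_codePmf_output (ch := ch) c i (fun w s p => (w,
    fun j : Fin n => if h : j.val < i then some (p ⟨j, h⟩).2 else none,
    maskFuture (i + 1) s)) v
  have e : ∀ ω : CodeSpace S Y₂ Y₃ M n, (ω.1,
      fun j : Fin n => if h : j.val < i then some (seqPast i ω.2.2 ⟨j, h⟩).2 else none,
      maskFuture (i + 1) ω.2.1) = codeAux i ω := by
    intro ω
    rw [codeAux, Prod.mk.injEq, Prod.mk.injEq]
    refine ⟨rfl, ?_, rfl⟩
    ext1 j
    rw [maskPast]
    split_ifs <;> rfl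
  simpa only [e] using h

/-- The right side is `H(Sᵢ | Vᵢ) - H(Y₃ᵢ | Vᵢ)`, the entropy of `Vᵢ` having cancelled. -/
theorem sum_entropyGap_codeAux (i : Fin n) :
    ∑ v, ch.entropyGap (fun k => rvLaw (ch.codePmf c)
        (fun ω => (codeAux i ω, codeInput c i ω)) (v, k)) =
      rvEntropy (ch.codePmf c) (fun ω => (codeAux i ω, ω.2.1 i)) -
        rvEntropy (ch.codePmf c) (fun ω => (codeAux i ω, destOutput ω i)) := by
  simp only [entropyGap, ← rvLaw_codePmf_aux_joint, Finset.sum_sub_distrib]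
  have h1 := rvEntropy_slices (rvLaw (ch.codePmf c)
    (fun ω => (codeAux i ω, codeInput c i ω, ω.2.2 i))) fun z => z.1.1
  have h2 := rvEntropy_slices (rvLaw (ch.codePmf c)
    (fun ω => (codeAux i ω, codeInput c i ω, ω.2.2 i))) fun z => z.2.2
  rw [← h1, ← h2, rvEntropy_rvLaw, rvEntropy_rvLaw]
  rfl

/-- The information which the destination obtains about the message. -/
theorem message_info_le_sum_entropyGap (hM : 0 < M) :
    rvEntropy (ch.codePmf c) (fun ω => ω.1) + rvEntropy (ch.codePmf c) destOutput -
        rvEntropy (ch.codePmf c) (fun ω => (ω.1, destOutput ω)) ≤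
      ∑ i, (∑ v, ch.entropyGap (fun k => rvLaw (ch.codePmf c)
          (fun ω => (codeAux i ω, codeInput c i ω)) (v, k)) -
        ch.entropyGap (rvLaw (ch.codePmf c) (codeInput c i))) := by
  have hμ := codePmf_nonneg (ch := ch) c
  have hμ1 := sum_codePmf (ch := ch) c hM
  -- Hybrid argument in place of Csiszár's sum identity: `a` interpolates from `H(W, Sⁿ)` to `H(W,
  -- Y₃ⁿ)`, and step `i` exchanges `Sᵢ` for `Y₃ᵢ` next to `Vᵢ`.
  set a : ℕ → ℝ := fun i => rvEntropy (ch.codePmf c)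
    (fun ω => (ω.1, maskPast i (destOutput ω), maskFuture i ω.2.1)) with ha
  have ha0 : a 0 = rvEntropy (ch.codePmf c) (fun ω => (ω.1, ω.2.1)) :=
    rvEntropy_congr fun ω ω' _ _ => by
      simp only [Prod.mk.injEq, maskFuture_zero_eq_iff]
      exact ⟨fun h => ⟨h.1, h.2.2⟩, fun h => ⟨h.1, maskPast_zero_eq, h.2⟩⟩
  have han : a n = rvEntropy (ch.codePmf c) (fun ω => (ω.1, destOutput ω)) :=
    rvEntropy_congr fun ω ω' _ _ => by
      simp only [Prod.mk.injEq, maskPast_length_eq_iff]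
      exact ⟨fun h => ⟨h.1, h.2.1⟩, fun h => ⟨h.1, h.2, maskFuture_length_eq⟩⟩
  set b : ℕ → ℝ := fun i => rvEntropy (ch.codePmf c) (fun ω => maskPast i (destOutput ω)) with hb
  have hb0 : b 0 = 0 := rvEntropy_const hμ1 fun ω ω' => maskPast_zero_eq
  have hbn : b n = rvEntropy (ch.codePmf c) destOutput :=
    rvEntropy_congr fun ω ω' _ _ => maskPast_length_eq_iff
  have hstep : ∀ i : Fin n, b (i + 1) - b i - (a (i + 1) - a i) -
      rvEntropy ch.Q (fun s => s) ≤
      ∑ v, ch.entropyGap (fun k => rvLaw (ch.codePmf c)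
          (fun ω => (codeAux i ω, codeInput c i ω)) (v, k)) -
        ch.entropyGap (rvLaw (ch.codePmf c) (codeInput c i)) := by
    intro i
    rw [sum_entropyGap_codeAux, entropyGap, rvEntropy_codePmf_joint, rvEntropy_codePmf_joint]
    have e1 : a i = rvEntropy (ch.codePmf c) (fun ω => (codeAux i ω, ω.2.1 i)) :=
      rvEntropy_congr fun ω ω' _ _ => by
        simp only [codeAux, Prod.mk.injEq, maskFuture_eq_iff_succ i]
        tauto
    have e2 : a (i + 1) = rvEntropy (ch.codePmf c) (fun ω => (codeAux i ω, destOutput ω i)) :=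
      rvEntropy_congr fun ω ω' _ _ => by
        simp only [codeAux, Prod.mk.injEq, maskPast_succ_eq_iff i]
        tauto
    have e3 : rvEntropy (ch.codePmf c) (fun ω => (codeInput c i ω).1) =
        rvEntropy ch.Q (fun s => s) := by
      have := rvLaw_codePmf_state (ch := ch) c hM i
      simp only [codeInput, rvEntropy, this, rvLaw_id]
    -- The only inequality of the step: the past is dropped from `H(Y₃ᵢ | Y₃^{i-1})`.
    have e4 : b (i + 1) ≤ rvEntropy (ch.codePmf c) (fun ω => (ω.2.2 i).2) + b i := by
      have e : b (i + 1) = rvEntropy (ch.codePmf c)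
          (fun ω => ((ω.2.2 i).2, maskPast i (destOutput ω))) :=
        rvEntropy_congr fun ω ω' _ _ => by
          simp only [maskPast_succ_eq_iff i, Prod.mk.injEq, destOutput]
      rw [e]
      exact rvEntropy_subadditive hμ hμ1 _ _
    rw [← e1, ← e2, e3]
    linarith
  have hsum := Finset.sum_le_sum fun i (_ : i ∈ Finset.univ) => hstep i
  rw [Finset.sum_sub_distrib, Finset.sum_sub_distrib, Fin.sum_univ_sub_telescope,
    Fin.sum_univ_sub_telescope, ha0, han, hb0, hbn, rvEntropy_message_states c hM,
    rvEntropy_states c hM] at hsum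
  simp only [Finset.sum_const, Finset.card_univ, Fintype.card_fin, nsmul_eq_mul] at hsum
  linarith

/-- Converse: a code with small error probability yields a large value of the single-letter
bound. -/
theorem exists_mem_boundValues_of_code [Nonempty X₁] [Nonempty X₂] (hM : 0 < M) (hn : 0 < n) :
    ∃ ρ ∈ ch.boundValues,
      Real.log M / Real.log 2 * (1 - ch.errorProb c) - 1 ≤ n * ρ := by
  have hμ := codePmf_nonneg (ch := ch) c
  have hn' : (0 : ℝ) < n := by exact_mod_cast hn
  set q : Fin n → S × X₁ × X₂ → ℝ := fun i => rvLaw (ch.codePmf c) (codeInput c i) with hq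
  -- The single-letter `V` consists of a uniform time index and `Vᵢ`.
  set r : Fin n × (Fin M × (Fin n → Option Y₃) × (Fin n → Option S)) → S × X₁ × X₂ → ℝ :=
    fun z k => rvLaw (ch.codePmf c) (fun ω => (codeAux z.1 ω, codeInput c z.1 ω)) (z.2, k) with hr
  have hq0 : ∀ i k, 0 ≤ q i k := fun i k => rvLaw_nonneg hμ _ _
  have hc1 : ∑ _i : Fin n, 1 / (n : ℝ) = 1 := by simp [hn'.ne']
  have hqr : (fun k => ∑ z, 1 / (n : ℝ) * r z k) = fun k => ∑ i, 1 / (n : ℝ) * q i k := by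
    ext k
    rw [Fintype.sum_prod_type]
    refine Finset.sum_congr rfl fun i _ => ?_
    rw [← Finset.mul_sum]
    congr 1
    exact (rvLaw_fst_marginal (ch.codePmf c) (codeAux i) (codeInput c i) k).symm
  have hqQ : ∀ i, rvLaw (q i) Prod.fst = ch.Q := fun i => by
    rw [hq, rvLaw_rvLaw]
    exact rvLaw_codePmf_state c hM i
  have hmarg : ∀ (a : S × X₁ × X₂ → ℝ) (s : S),
      rvLaw a Prod.fst s = ∑ x₁, ∑ x₂, a (s, x₁, x₂) := by
    intro a s
    rw [rvLaw, Fintype.sum_prod_type, Finset.sum_eq_single s]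
    · simp [Fintype.sum_prod_type]
    · intro s' _ h; simp [h]
    · simp
  obtain ⟨ρ, hρ, hle⟩ := exists_mem_boundValues (ch := ch) (c := fun _ => 1 / (n : ℝ))
    (fun _ => by positivity) (r := r) (fun z k => rvLaw_nonneg hμ _ _) (fun s => by
      rw [← hmarg (fun k => ∑ z, 1 / (n : ℝ) * r z k) s, hqr, rvLaw_sum_mul]
      simp only [hqQ, ← Finset.sum_mul, hc1, one_mul])
  refine ⟨ρ, hρ, ?_⟩
  rw [hqr] at hle
  have hfano := rvEntropy_fano hμ (sum_codePmf c hM) (fun ω => ω.1) destOutput c.decoder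
  rw [← errorProb_eq] at hfano
  have hA := message_info_le_sum_broadcastTerm (ch := ch) c hM
  have hB := message_info_le_sum_entropyGap (ch := ch) c hM
  rw [rvEntropy_message c hM] at hA hB
  have hA' := sum_mul_broadcastTerm_le (ch := ch) (c := fun _ : Fin n => 1 / (n : ℝ))
    (fun _ => by positivity) hq0
  have hB' := entropyGap_sum_mul_le (ch := ch) (c := fun _ : Fin n => 1 / (n : ℝ))
    (fun _ => by positivity) hc1 hq0 hqQ
  rw [← Finset.mul_sum] at hA' hB'
  rw [← Finset.mul_sum, Fintype.sum_prod_type] at hle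
  rw [Finset.sum_sub_distrib] at hB
  have hmin : (Real.log M / Real.log 2 * (1 - ch.errorProb c) - 1) / n ≤
      min (ch.broadcastTerm fun k => ∑ i, 1 / (n : ℝ) * q i k)
        (1 / (n : ℝ) * ∑ i, ∑ v, ch.entropyGap (r (i, v)) -
          ch.entropyGap fun k => ∑ i, 1 / (n : ℝ) * q i k) := by
    refine le_min (le_trans ?_ hA') (le_trans ?_ (sub_le_sub_left hB' _))
    · rw [div_eq_inv_mul, one_div]
      refine mul_le_mul_of_nonneg_left ?_ (by positivity)
      refine le_trans ?_ hA
      linarith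
    · rw [← mul_sub, div_eq_inv_mul, one_div]
      refine mul_le_mul_of_nonneg_left ?_ (by positivity)
      refine le_trans ?_ hB
      linarith
  have := hmin.trans hle
  rwa [div_le_iff₀ hn', mul_comm ρ] at this

end StateRelayChannel

/-! ### Attainment of the maximum, and the passage to the limit. -/

theorem continuous_rvEntropy {Ω A : Type*} [Fintype Ω] [Fintype A] (X : Ω → A) :
    Continuous fun μ : Ω → ℝ => rvEntropy μ X := by
  unfold rvEntropy rvLaw
  refine continuous_finsetSum _ fun a _ => (Real.continuous_negMulLog.comp ?_).div_const _
  refine continuous_finsetSum _ fun ω _ => ?_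
  split_ifs
  exacts [continuous_apply ω, continuous_const]

theorem continuous_rvCondEntropy {Ω A C : Type*} [Fintype Ω] [Fintype A] [Fintype C]
    (X : Ω → A) (Z : Ω → C) : Continuous fun μ : Ω → ℝ => rvCondEntropy μ X Z :=
  (continuous_rvEntropy _).sub (continuous_rvEntropy _)

theorem continuous_rvMutualInfo {Ω A B : Type*} [Fintype Ω] [Fintype A] [Fintype B]
    (X : Ω → A) (Y : Ω → B) : Continuous fun μ : Ω → ℝ => rvMutualInfo μ X Y :=
  (continuous_rvEntropy _).sub (continuous_rvCondEntropy _ _)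

theorem continuous_rvCondMutualInfo {Ω A B C : Type*} [Fintype Ω] [Fintype A] [Fintype B]
    [Fintype C] (X : Ω → A) (Y : Ω → B) (Z : Ω → C) :
    Continuous fun μ : Ω → ℝ => rvCondMutualInfo μ X Y Z :=
  (continuous_rvCondEntropy _ _).sub (continuous_rvCondEntropy _ _)

namespace StateRelayChannel

variable {S X₁ X₂ Y₂ Y₃ : Type*}
  [Fintype S] [Fintype X₁] [Fintype X₂] [Fintype Y₂] [Fintype Y₃]
  (ch : StateRelayChannel S X₁ X₂ Y₂ Y₃)

theorem continuous_boundObjective {U V : Type*} [Fintype U] [Fintype V] :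
    Continuous fun μ : S × U × V × X₁ × X₂ × Y₂ × Y₃ → ℝ => boundObjective μ := by
  unfold boundObjective
  exact ((continuous_rvCondMutualInfo _ _ _).sub (continuous_rvCondMutualInfo _ _ _)).min
    ((continuous_rvMutualInfo _ _).sub (continuous_rvMutualInfo _ _))

/-- Test laws are the continuous image of a product of simplices of kernels. -/
theorem isCompact_setOf_isTestLaw (U V : Type*) [Fintype U] [Fintype V] :
    IsCompact {μ : S × U × V × X₁ × X₂ × Y₂ × Y₃ → ℝ | ch.IsTestLaw μ} := by
  have hK : IsCompact ((Set.univ.pi fun _ : S => stdSimplex ℝ U) ×ˢ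
      ((Set.univ.pi fun _ : U => Set.univ.pi fun _ : S => stdSimplex ℝ X₂) ×ˢ
      (Set.univ.pi fun _ : U => Set.univ.pi fun _ : S => stdSimplex ℝ (V × X₁)))) :=
    (isCompact_univ_pi fun _ => isCompact_stdSimplex ℝ _).prod
      ((isCompact_univ_pi fun _ => isCompact_univ_pi fun _ => isCompact_stdSimplex ℝ _).prod
        (isCompact_univ_pi fun _ => isCompact_univ_pi fun _ => isCompact_stdSimplex ℝ _))
  have hf : Continuous fun (p : (S → U → ℝ) × (U → S → X₂ → ℝ) × (U → S → V × X₁ → ℝ))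
      (z : S × U × V × X₁ × X₂ × Y₂ × Y₃) =>
      ch.Q z.1 * p.1 z.1 z.2.1 * p.2.1 z.2.1 z.1 z.2.2.2.2.1 *
        p.2.2 z.2.1 z.1 (z.2.2.1, z.2.2.2.1) *
        ch.W z.2.2.2.1 z.2.2.2.2.1 z.1 (z.2.2.2.2.2.1, z.2.2.2.2.2.2) := by
    fun_prop
  convert hK.image hf using 1
  ext μ
  constructor
  · rintro ⟨p, q, l, hp, hq, hl, h⟩
    exact ⟨(p, q, l), ⟨fun s _ => hp s, fun u _ s _ => hq u s, fun u _ s _ => hl u s⟩,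
      funext fun z => (h _ _ _ _ _ _ _).symm⟩
  · rintro ⟨⟨p, q, l⟩, ⟨hp, hq, hl⟩, rfl⟩
    exact ⟨p, q, l, fun s => hp s trivial, fun u s => hq u trivial s trivial,
      fun u s => hl u trivial s trivial, fun _ _ _ _ _ _ _ => rfl⟩

/-- The cardinality bounds enter here: they make the union over alphabet sizes finite. -/
theorem isCompact_boundValues : IsCompact ch.boundValues := by
  have h : ch.boundValues =
      ⋃ a ∈ Set.Iic (Fintype.card S * Fintype.card X₁ * Fintype.card X₂),
      ⋃ b ∈ Set.Iic ((Fintype.card S * Fintype.card X₁ * Fintype.card X₂) ^ 2),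
        boundObjective '' {μ : S × Fin a × Fin b × X₁ × X₂ × Y₂ × Y₃ → ℝ | ch.IsTestLaw μ} := by
    ext r
    simp only [boundValues, Set.mem_ofPred_eq, Set.mem_iUnion, Set.mem_Iic, Set.mem_image,
      exists_prop]
    constructor
    · rintro ⟨a, b, ha, hb, μ, hμ, rfl⟩
      exact ⟨a, ha, b, hb, μ, hμ, rfl⟩
    · rintro ⟨a, ha, b, hb, μ, hμ, rfl⟩
      exact ⟨a, b, ha, hb, μ, hμ, rfl⟩
  rw [h]
  exact (Set.finite_Iic _).isCompact_biUnion fun a _ =>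
    (Set.finite_Iic _).isCompact_biUnion fun b _ =>
      (ch.isCompact_setOf_isTestLaw (Fin a) (Fin b)).image continuous_boundObjective

/-- Constant inputs give a one-term mixture to which `exists_mem_boundValues` applies. -/
theorem boundValues_nonempty [Nonempty X₁] [Nonempty X₂] : ch.boundValues.Nonempty := by
  classical
  obtain ⟨x₁⟩ := ‹Nonempty X₁›
  obtain ⟨x₂⟩ := ‹Nonempty X₂›
  obtain ⟨ρ, hρ, -⟩ := exists_mem_boundValues (ch := ch) (c := fun _ : Unit => 1)
    (fun _ => zero_le_one)
    (r := fun _ (k : S × X₁ × X₂) =>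
      ch.Q k.1 * ((if k.2.1 = x₁ then 1 else 0) * if k.2.2 = x₂ then 1 else 0))
    (fun _ k => mul_nonneg (ch.Q_mem.1 _) (by split_ifs <;> simp)) (fun s => by simp)
  exact ⟨ρ, hρ⟩

/-- An achievable rate is at most every upper bound of the single-letter values. -/
theorem Achievable.le_of_mem_upperBounds [Nonempty X₁] [Nonempty X₂]
    {ch : StateRelayChannel S X₁ X₂ Y₂ Y₃} {R B : ℝ} (hR : ch.Achievable R)
    (hB : B ∈ upperBounds ch.boundValues) : R ≤ B := by
  obtain ⟨hR0, ε, hε, hcode⟩ := hR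
  have hbound : ∀ᶠ n : ℕ in Filter.atTop, R * (1 - ε n) - 1 / (n : ℝ) ≤ B := by
    -- `ε n < 1` makes the factor `1 - ε n` nonnegative, so that it can multiply the lower bound `n
    -- R ≤ log₂ M`.
    filter_upwards [hε.eventually_lt_const one_pos, Filter.eventually_ge_atTop 1] with n hn1 hn
    obtain ⟨c, hc⟩ := hcode n hn
    have hn' : (0 : ℝ) < n := by exact_mod_cast hn
    have hpow : (0 : ℝ) < 2 ^ ((n : ℝ) * R) := by positivity
    have hM : 0 < ⌈(2 : ℝ) ^ ((n : ℝ) * R)⌉₊ := Nat.ceil_pos.2 hpow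
    obtain ⟨ρ, hρ, hle⟩ := exists_mem_boundValues_of_code (ch := ch) c hM hn
    have h2 : 0 < Real.log 2 := Real.log_pos one_lt_two
    have hlog : n * R ≤ Real.log ⌈(2 : ℝ) ^ ((n : ℝ) * R)⌉₊ / Real.log 2 := by
      rw [le_div_iff₀ h2, ← Real.log_rpow two_pos]
      exact Real.log_le_log hpow (Nat.le_ceil _)
    have h1 : n * R * (1 - ε n) ≤
        Real.log ⌈(2 : ℝ) ^ ((n : ℝ) * R)⌉₊ / Real.log 2 * (1 - ch.errorProb c) :=
      mul_le_mul hlog (by linarith) (by linarith) ((by positivity : 0 ≤ n * R).trans hlog)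
    have h3 : n * ρ ≤ n * B := mul_le_mul_of_nonneg_left (hB hρ) hn'.le
    refine le_of_mul_le_mul_left ?_ hn'
    rw [mul_sub, mul_one_div_cancel hn'.ne']
    linarith
  have hlim : Filter.Tendsto (fun n : ℕ => R * (1 - ε n) - 1 / (n : ℝ)) Filter.atTop (nhds R) := by
    have := ((tendsto_const_nhds (x := R)).mul ((tendsto_const_nhds (x := (1 : ℝ))).sub hε)).sub
      tendsto_one_div_atTop_nhds_zero_nat
    simpa using this
  exact le_of_tendsto hlim hbound

end StateRelayChannel

end

theorem theorem3 {S X₁ X₂ Y₂ Y₃ : Type*}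
    [Fintype S] [Fintype X₁] [Fintype X₂] [Fintype Y₂] [Fintype Y₃]
    [Nonempty X₁] [Nonempty X₂]
    (ch : StateRelayChannel S X₁ X₂ Y₂ Y₃) :
    ∃ Rup : ℝ, IsGreatest ch.boundValues Rup ∧ ch.capacity ≤ (Rup : EReal) := by
  obtain ⟨B, hB⟩ := ch.isCompact_boundValues.exists_isGreatest ch.boundValues_nonempty
  refine ⟨B, hB, sSup_le ?_⟩
  rintro _ ⟨R, hR, rfl⟩
  exact EReal.coe_le_coe_iff.2 (StateRelayChannel.Achievable.le_of_mem_upperBounds hR hB.2)
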